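/- **Conventions.** Let $\Delta=\mathbb C[z]\langle\tau,\tau^{-1}\rangle$ with $\tau z=(z-1)\tau$ be the ring of difference operators on $\mathbb A^1$, and let $\mathcal D_{\mathbb G_m}=\mathbb C[x,x^{-1}]\langle\partial_x\rangle$. The Mellin transform $\mathcal M:\mathrm{Mod}(\mathcal D_{\mathbb G_m})\to\mathrm{Mod}(\Delta)$ is induced by the ring isomorphism $\tau\leftrightarrow x$, $z\leftrightarrow x\partial_x$. Let $\mathcal D_{K_0}=\mathbb C((x))\langle\partial_x\rangle$, and let $\mathcal D_{K_\infty}=\mathbb C((y))\langle\partial_y\rangle$ with $y=x^{-1}$, so that $x\partial_x=-y\partial_y$. Let $\mathring\jmath_{0*}$ and $\mathring\jmath_{\infty*}$ denote the forgetful functors from $\mathcal D_{K_0}$-modules, respectively $\mathcal D_{K_\infty}$-modules, to $\mathcal D_{\mathbb G_m}$-modules. For $q\in\mathbb C$, a $\mathcal D_{K_0}$-module $F$ is in $\mathcal Hol(\mathcal D_{K_0})^{\mathrm{reg},(q)}$ (holonomic, regular, with leading term in $q+\mathbb Z$) if it is finite dimensional over $\mathbb C((x))$ and, for some $k\in\mathbb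 Z$ and some $n\ge 0$, it has a $\mathbb C[[x]]$-lattice $L$ with $x\partial_x L\subseteq L$ and $(x\partial_x-q-k)^nL\subseteq xL$. The category $\mathcal Hol(\mathcal D_{K_\infty})^{\mathrm{reg},(q)}$ is defined in the same way with $y,\partial_y$ in place of $x,\partial_x$. For a $\mathbb C[[z-p]]$-module $N$ of finite length put $\iota_{p!}^{\to}N=\mathbb C((\tau))\otimes_{\mathbb C}N$ and $\iota_{p!}^{\gets}N=\mathbb C((\tau^{-1}))\otimes_{\mathbb C}N$; these are $\Delta$-modules, where $\tau^{\pm1}$ acts on the left factor and $z$ acts by $z(\tau^n\otimes m)=\tau^n\otimes(z+n)m$ (extended continuously). For a $\Delta$-module $M$ let $\iota_p^!M=\{m\in M:\exists n,\ (z-p)^nm=0\}$, which is a $\mathbb C[[z-p]]$-module. The $\tau$-adic topology on a $\mathbb C[[\tau]]$-module has as a basis of neighbourhoods of $0$ the subspaces $U$ such that for every finitely generated $\mathbb C[[\tau]]$-submodule $N$ there is $k$ with $\tau^kN\subseteq U$; the $\tau^{-1}$-adic topology on a $\mathbb C[[\tau^{-1}]]$-module is defined in the same way. **Theorem.** Let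 $p\in\mathbb C$. 1) The functor $\mathcal M^{(0,p+\mathbb Z)}F:=\iota_p^!\big(\mathcal M(\mathring\jmath_{0*}F)\big)$ takes $\mathcal Hol(\mathcal D_{K_0})^{\mathrm{reg},(p)}$ to the category of $\mathbb C[[z-p]]$-modules of finite length, and it is an equivalence between these categories. There is an isomorphism of $\Delta$-modules $$\mathcal M(\mathring\jmath_{0*}F)\overset{\sim}{\longrightarrow}\iota_{p!}^{\to}\big(\mathcal M^{(0,p+\mathbb Z)}F\big),$$ functorial in $F\in\mathcal Hol(\mathcal D_{K_0})^{\mathrm{reg},(p)}$, which is a homeomorphism for the $\tau$-adic topologies. This determines $\mathcal M^{(0,p+\mathbb Z)}$: every functor $G$ between the two categories that admits a functorial isomorphism $\mathcal M(\mathring\jmath_{0*}F)\cong\iota_{p!}^{\to}(G(F))$ which is a homeomorphism for the $\tau$-adic topologies is naturally isomorphic to $\mathcal M^{(0,p+\mathbb Z)}$. 2) The functor $\mathcal M^{(\infty,p+\mathbb Z)}F:=\iota_p^!\big(\mathcal M(\mathring\jmath_{\infty*}F)\big)$ takes $\mathcal Hol(\mathcal D_{K_\infty})^{\mathrm{reg},(-p)}$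 to the category of $\mathbb C[[z-p]]$-modules of finite length, and it is an equivalence between these categories. There is an isomorphism of $\Delta$-modules $$\mathcal M(\mathring\jmath_{\infty*}F)\overset{\sim}{\longrightarrow}\iota_{p!}^{\gets}\big(\mathcal M^{(\infty,p+\mathbb Z)}F\big),$$ functorial in $F\in\mathcal Hol(\mathcal D_{K_\infty})^{\mathrm{reg},(-p)}$, which is a homeomorphism for the $\tau^{-1}$-adic topologies. This determines $\mathcal M^{(\infty,p+\mathbb Z)}$ up to natural isomorphism, in the same sense. -/

import Mathlib

open CategoryTheory
open scoped TensorProduct PowerSeries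

universe u

noncomputable section

namespace LocalMellin

/-! ### The ring of difference operators `ℂ[z]⟨τ, τ⁻¹⟩` on the affine line -/

/-- Generators of the ring of difference operators. -/
inductive DiffGen : Type
  | z : DiffGen
  | t : DiffGen
  | tinv : DiffGen

/-- Relations of the ring of difference operators: `τ τ⁻¹ = τ⁻¹ τ = 1` and `τ z = (z - 1) τ`. -/
inductive DiffRel : FreeAlgebra ℂ DiffGen → FreeAlgebra ℂ DiffGen → Prop
  | t_tinv : DiffRel (FreeAlgebra.ι ℂ .t * FreeAlgebra.ι ℂ .tinv) 1
  | tinv_t : DiffRel (FreeAlgebra.ι ℂ .tinv * FreeAlgebra.ι ℂ .t) 1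
  | t_z : DiffRel (FreeAlgebra.ι ℂ .t * FreeAlgebra.ι ℂ .z)
      ((FreeAlgebra.ι ℂ .z - 1) * FreeAlgebra.ι ℂ .t)

/-- The ring `ℂ[z]⟨τ, τ⁻¹⟩` of difference operators on the affine line, by generators and
relations. -/
def DiffRing : Type := RingQuot DiffRel

namespace DiffRing

instance : Ring DiffRing := inferInstanceAs (Ring (RingQuot DiffRel))

instance : Algebra ℂ DiffRing := inferInstanceAs (Algebra ℂ (RingQuot DiffRel))

/-- The quotient map from the free algebra. -/
def mk : FreeAlgebra ℂ DiffGen →ₐ[ℂ] DiffRing := RingQuot.mkAlgHom ℂ DiffRel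

/-- The coordinate `z`. -/
def z : DiffRing := mk (FreeAlgebra.ι ℂ .z)

/-- The translation `τ`. -/
def t : DiffRing := mk (FreeAlgebra.ι ℂ .t)

/-- The inverse translation `τ⁻¹`. -/
def tinv : DiffRing := mk (FreeAlgebra.ι ℂ .tinv)

lemma t_mul_tinv : t * tinv = 1 := by
  have h := RingQuot.mkAlgHom_rel ℂ DiffRel.t_tinv
  rw [map_mul, map_one] at h
  exact h

lemma tinv_mul_t : tinv * t = 1 := by
  have h := RingQuot.mkAlgHom_rel ℂ DiffRel.tinv_t
  rw [map_mul, map_one] at h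
  exact h

lemma t_mul_z : t * z = (z - 1) * t := by
  have h := RingQuot.mkAlgHom_rel ℂ DiffRel.t_z
  rw [map_mul, map_mul, map_sub, map_one] at h
  exact h

/-- The universal property of the ring of difference operators. -/
def lift {A : Type*} [Ring A] [Algebra ℂ A] (a b c : A) (h₁ : b * c = 1) (h₂ : c * b = 1)
    (h₃ : b * a = (a - 1) * b) : DiffRing →ₐ[ℂ] A :=
  RingQuot.liftAlgHom ℂ ⟨FreeAlgebra.lift ℂ (fun g => match g with
    | .z => a
    | .t => b
    | .tinv => c), by
      intro x y hxy
      cases hxy <;> simp [h₁, h₂, h₃]⟩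

section lift
variable {A : Type*} [Ring A] [Algebra ℂ A] (a b c : A) (h₁ : b * c = 1) (h₂ : c * b = 1)
    (h₃ : b * a = (a - 1) * b)

lemma lift_z : lift a b c h₁ h₂ h₃ z = a := by
  refine (RingQuot.liftAlgHom_mkAlgHom_apply ..).trans ?_
  simp

lemma lift_t : lift a b c h₁ h₂ h₃ t = b := by
  refine (RingQuot.liftAlgHom_mkAlgHom_apply ..).trans ?_
  simp

lemma lift_tinv : lift a b c h₁ h₂ h₃ tinv = c := by
  refine (RingQuot.liftAlgHom_mkAlgHom_apply ..).trans ?_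
  simp

end lift

/-- Induction principle: a property holding for scalars and generators and stable under sums and
products holds everywhere. -/
lemma induction {P : DiffRing → Prop} (hc : ∀ c : ℂ, P (algebraMap ℂ DiffRing c))
    (hz : P z) (ht : P t) (htinv : P tinv) (hadd : ∀ a b, P a → P b → P (a + b))
    (hmul : ∀ a b, P a → P b → P (a * b)) (a : DiffRing) : P a := by
  obtain ⟨x, rfl⟩ : ∃ x, mk x = a := RingQuot.mkAlgHom_surjective ℂ DiffRel a
  induction x using FreeAlgebra.induction with
  | grade0 r => rw [AlgHom.commutes]; exact hc r
  | grade1 g => cases g <;> assumption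
  | mul x y hx hy => rw [map_mul]; exact hmul _ _ hx hy
  | add x y hx hy => rw [map_add]; exact hadd _ _ hx hy

lemma algHom_ext {A : Type*} [Ring A] [Algebra ℂ A] {f g : DiffRing →ₐ[ℂ] A}
    (hz : f z = g z) (ht : f t = g t) (htinv : f tinv = g tinv) : f = g := by
  ext a
  refine induction (P := fun a => f a = g a) (fun c => ?_) hz ht htinv (fun a b ha hb => ?_)
    (fun a b ha hb => ?_) a
  · simp
  · simp [ha, hb]
  · simp [ha, hb]

end DiffRing

/-! ### The ring of differential operators `ℂ[x, x⁻¹]⟨∂⟩` on the punctured line -/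

/-- Generators of the ring of differential operators on `𝔾ₘ`. -/
inductive GmGen : Type
  | x : GmGen
  | xinv : GmGen
  | d : GmGen

/-- Relations: `x x⁻¹ = x⁻¹ x = 1` and `∂ x = x ∂ + 1`. -/
inductive GmRel : FreeAlgebra ℂ GmGen → FreeAlgebra ℂ GmGen → Prop
  | x_xinv : GmRel (FreeAlgebra.ι ℂ .x * FreeAlgebra.ι ℂ .xinv) 1
  | xinv_x : GmRel (FreeAlgebra.ι ℂ .xinv * FreeAlgebra.ι ℂ .x) 1
  | d_x : GmRel (FreeAlgebra.ι ℂ .d * FreeAlgebra.ι ℂ .x)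
      (FreeAlgebra.ι ℂ .x * FreeAlgebra.ι ℂ .d + 1)

/-- The ring `ℂ[x, x⁻¹]⟨∂⟩` of differential operators on the punctured line `𝔾ₘ`. -/
def GmRing : Type := RingQuot GmRel

namespace GmRing

instance : Ring GmRing := inferInstanceAs (Ring (RingQuot GmRel))

instance : Algebra ℂ GmRing := inferInstanceAs (Algebra ℂ (RingQuot GmRel))

/-- The quotient map from the free algebra. -/
def mk : FreeAlgebra ℂ GmGen →ₐ[ℂ] GmRing := RingQuot.mkAlgHom ℂ GmRel

/-- The coordinate `x`. -/
def x : GmRing := mk (FreeAlgebra.ι ℂ .x)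

/-- The inverse `x⁻¹` of the coordinate. -/
def xinv : GmRing := mk (FreeAlgebra.ι ℂ .xinv)

/-- The derivation `∂`. -/
def d : GmRing := mk (FreeAlgebra.ι ℂ .d)

lemma x_mul_xinv : x * xinv = 1 := by
  have h := RingQuot.mkAlgHom_rel ℂ GmRel.x_xinv
  rw [map_mul, map_one] at h
  exact h

lemma xinv_mul_x : xinv * x = 1 := by
  have h := RingQuot.mkAlgHom_rel ℂ GmRel.xinv_x
  rw [map_mul, map_one] at h
  exact h

lemma d_mul_x : d * x = x * d + 1 := by
  have h := RingQuot.mkAlgHom_rel ℂ GmRel.d_x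
  rw [map_mul, map_add, map_mul, map_one] at h
  exact h

/-- The universal property of `ℂ[x, x⁻¹]⟨∂⟩`. -/
def lift {A : Type*} [Ring A] [Algebra ℂ A] (a b c : A) (h₁ : a * b = 1) (h₂ : b * a = 1)
    (h₃ : c * a = a * c + 1) : GmRing →ₐ[ℂ] A :=
  RingQuot.liftAlgHom ℂ ⟨FreeAlgebra.lift ℂ (fun g => match g with
    | .x => a
    | .xinv => b
    | .d => c), by
      intro x y hxy
      cases hxy <;> simp [h₁, h₂, h₃]⟩

section lift
variable {A : Type*} [Ring A] [Algebra ℂ A] (a b c : A) (h₁ : a * b = 1) (h₂ : b * a = 1)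
    (h₃ : c * a = a * c + 1)

lemma lift_x : lift a b c h₁ h₂ h₃ x = a := by
  refine (RingQuot.liftAlgHom_mkAlgHom_apply ..).trans ?_
  simp

lemma lift_xinv : lift a b c h₁ h₂ h₃ xinv = b := by
  refine (RingQuot.liftAlgHom_mkAlgHom_apply ..).trans ?_
  simp

lemma lift_d : lift a b c h₁ h₂ h₃ d = c := by
  refine (RingQuot.liftAlgHom_mkAlgHom_apply ..).trans ?_
  simp

end lift

/-- Two algebra maps out of `ℂ[x, x⁻¹]⟨∂⟩` agree if they agree on the generators. -/
lemma algHom_ext {A : Type*} [Ring A] [Algebra ℂ A] {f g : GmRing →ₐ[ℂ] A}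
    (hx : f x = g x) (hxinv : f xinv = g xinv) (hd : f d = g d) : f = g := by
  have h : f.comp mk = g.comp mk := by
    apply FreeAlgebra.hom_ext
    funext i
    cases i <;> assumption
  ext a
  obtain ⟨y, rfl⟩ : ∃ y, mk y = a := RingQuot.mkAlgHom_surjective ℂ GmRel a
  exact DFunLike.congr_fun h y

end GmRing

/-! ### The Mellin transform -/

/-- The ring isomorphism `ℂ[z]⟨τ, τ⁻¹⟩ ≅ ℂ[x, x⁻¹]⟨∂⟩` with `τ ↔ x` and `z ↔ x ∂`. -/
def mellinRingEquiv : DiffRing ≃ₐ[ℂ] GmRing :=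
  AlgEquiv.ofAlgHom
    (DiffRing.lift (GmRing.x * GmRing.d) GmRing.x GmRing.xinv GmRing.x_mul_xinv
      GmRing.xinv_mul_x (by
        rw [sub_mul, one_mul, mul_assoc, GmRing.d_mul_x, mul_add, mul_one, add_sub_cancel_right]))
    (GmRing.lift DiffRing.t DiffRing.tinv (DiffRing.tinv * DiffRing.z) DiffRing.t_mul_tinv
      DiffRing.tinv_mul_t (by
        have h : DiffRing.z * DiffRing.t = DiffRing.t * DiffRing.z + DiffRing.t := by
          rw [DiffRing.t_mul_z]; noncomm_ring
        rw [mul_assoc, h, mul_add, ← mul_assoc, ← mul_assoc, DiffRing.tinv_mul_t,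
          DiffRing.t_mul_tinv]))
    (GmRing.algHom_ext
      (by simp [GmRing.lift_x, DiffRing.lift_t])
      (by simp [GmRing.lift_xinv, DiffRing.lift_tinv])
      (by simp [GmRing.lift_d, DiffRing.lift_tinv, DiffRing.lift_z, ← mul_assoc,
        GmRing.xinv_mul_x]))
    (DiffRing.algHom_ext
      (by simp [GmRing.lift_x, GmRing.lift_d, DiffRing.lift_z, ← mul_assoc, DiffRing.t_mul_tinv])
      (by simp [GmRing.lift_x, DiffRing.lift_t])
      (by simp [GmRing.lift_xinv, DiffRing.lift_tinv]))

/-- The Mellin transform from `D`-modules on `𝔾ₘ` to difference modules on the affine line: the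
same vector space, with `τ` acting as `x` and `z` acting as `x ∂`. -/
def mellin : ModuleCat.{u} GmRing ⥤ ModuleCat.{u} DiffRing :=
  ModuleCat.restrictScalars (mellinRingEquiv : DiffRing →+* GmRing)

/-! ### The ring of differential operators `ℂ((x))⟨∂⟩` on the punctured formal disk -/

/-- Generators of `ℂ((x))⟨∂⟩`: all Laurent series, and `∂`. -/
inductive KGen : Type
  | f : LaurentSeries ℂ → KGen
  | d : KGen

/-- Relations of `ℂ((x))⟨∂⟩`: those of the `ℂ`-algebra `ℂ((x))`, and `∂ f = f ∂ + f'`. -/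
inductive KRel : FreeAlgebra ℂ KGen → FreeAlgebra ℂ KGen → Prop
  | scalar (c : ℂ) : KRel (FreeAlgebra.ι ℂ (.f (HahnSeries.C c)))
      (algebraMap ℂ (FreeAlgebra ℂ KGen) c)
  | add (f g : LaurentSeries ℂ) : KRel (FreeAlgebra.ι ℂ (.f (f + g)))
      (FreeAlgebra.ι ℂ (.f f) + FreeAlgebra.ι ℂ (.f g))
  | mul (f g : LaurentSeries ℂ) : KRel (FreeAlgebra.ι ℂ (.f (f * g)))
      (FreeAlgebra.ι ℂ (.f f) * FreeAlgebra.ι ℂ (.f g))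
  | leibniz (f : LaurentSeries ℂ) : KRel (FreeAlgebra.ι ℂ .d * FreeAlgebra.ι ℂ (.f f))
      (FreeAlgebra.ι ℂ (.f f) * FreeAlgebra.ι ℂ .d
        + FreeAlgebra.ι ℂ (.f (LaurentSeries.derivative ℂ f)))

/-- The ring `ℂ((x))⟨∂⟩` of differential operators on a punctured formal disk with coordinate
`x`. -/
def KRing : Type := RingQuot KRel

namespace KRing

instance : Ring KRing := inferInstanceAs (Ring (RingQuot KRel))

instance : Algebra ℂ KRing := inferInstanceAs (Algebra ℂ (RingQuot KRel))

/-- The quotient map from the free algebra. -/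
def mk : FreeAlgebra ℂ KGen →ₐ[ℂ] KRing := RingQuot.mkAlgHom ℂ KRel

/-- The derivation `∂`. -/
def d : KRing := mk (FreeAlgebra.ι ℂ .d)

/-- The inclusion of the Laurent series. -/
def ofSeries : LaurentSeries ℂ →+* KRing where
  toFun f := mk (FreeAlgebra.ι ℂ (.f f))
  map_one' := by
    have h := RingQuot.mkAlgHom_rel ℂ (KRel.scalar 1)
    rw [map_one, map_one, map_one] at h
    exact h
  map_zero' := by
    have h := RingQuot.mkAlgHom_rel ℂ (KRel.scalar 0)
    rw [map_zero, map_zero, map_zero] at h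
    exact h
  map_add' f g := by
    have h := RingQuot.mkAlgHom_rel ℂ (KRel.add f g)
    rw [map_add] at h
    exact h
  map_mul' f g := by
    have h := RingQuot.mkAlgHom_rel ℂ (KRel.mul f g)
    rw [map_mul] at h
    exact h

lemma ofSeries_C (c : ℂ) :
    ofSeries (HahnSeries.C c) = algebraMap ℂ KRing c := by
  have h := RingQuot.mkAlgHom_rel ℂ (KRel.scalar c)
  rw [AlgHom.commutes] at h
  exact h

lemma d_mul_ofSeries (f : LaurentSeries ℂ) :
    d * ofSeries f = ofSeries f * d + ofSeries (LaurentSeries.derivative ℂ f) := by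
  have h := RingQuot.mkAlgHom_rel ℂ (KRel.leibniz f)
  rw [map_mul, map_add, map_mul] at h
  exact h

end KRing

/-- The `n`-th power, `n ∈ ℤ`, of the variable as a Laurent series. -/
def xpow (n : ℤ) : LaurentSeries ℂ := HahnSeries.single n 1

lemma xpow_mul (m n : ℤ) : xpow m * xpow n = xpow (m + n) := by
  simp [xpow, HahnSeries.single_mul_single]

lemma xpow_zero : xpow 0 = 1 := rfl

lemma derivative_xpow (n : ℤ) :
    LaurentSeries.derivative ℂ (xpow n) = HahnSeries.C (n : ℂ) * xpow (n - 1) := by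
  rw [LaurentSeries.derivative_apply, xpow, LaurentSeries.hasseDeriv_single]
  rw [xpow, HahnSeries.C_apply, HahnSeries.single_mul_single]
  simp

namespace KRing

/-- The Euler operator `x ∂`. -/
def xd : KRing := ofSeries (xpow 1) * d

section
variable (V : Type u) [AddCommGroup V] [Module KRing V]

/-- A `ℂ((x))⟨∂⟩`-module is a vector space over `ℂ((x))`. -/
@[reducible] def laurentModule : Module (LaurentSeries ℂ) V := Module.compHom V ofSeries

/-- A `ℂ((x))⟨∂⟩`-module is a module over `ℂ[[x]]`. -/
@[reducible] def powerModule : Module ℂ⟦X⟧ V :=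
  Module.compHom V (ofSeries.comp (algebraMap ℂ⟦X⟧ (LaurentSeries ℂ)))

attribute [local instance] laurentModule powerModule

/-- A module over `ℂ((x))⟨∂⟩` is holonomic if it is finite dimensional over `ℂ((x))`. -/
def IsHolonomic : Prop := Module.Finite (LaurentSeries ℂ) V

variable {V} in
/-- A lattice in a `ℂ((x))⟨∂⟩`-module: a finitely generated `ℂ[[x]]`-submodule which spans it over
`ℂ((x))`. -/
def IsLattice (L : Submodule ℂ⟦X⟧ V) : Prop :=
  L.FG ∧ Submodule.span (LaurentSeries ℂ) (L : Set V) = ⊤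

/-- Regular singularities: there is a lattice which is stable under `x ∂`. -/
def IsRegular : Prop :=
  ∃ L : Submodule ℂ⟦X⟧ V, IsLattice L ∧ ∀ v ∈ L, xd • v ∈ L

/-- `x ∂` has leading term `q`: there is a lattice `L`, stable under `x ∂`, such that
`x ∂ - q` acts nilpotently on `L / x L`. -/
def HasLeadingTerm (q : ℂ) : Prop :=
  ∃ L : Submodule ℂ⟦X⟧ V, IsLattice L ∧ (∀ v ∈ L, xd • v ∈ L) ∧
    ∃ n : ℕ, ∀ v ∈ L, ∃ w ∈ L, (xd - algebraMap ℂ KRing q) ^ n • v = (PowerSeries.X : ℂ⟦X⟧) • w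

end

/-- The regular holonomic `ℂ((x))⟨∂⟩`-modules with leading term in `p + ℤ`. -/
def regHol (p : ℂ) : ObjectProperty (ModuleCat.{u} KRing) := fun F =>
  IsHolonomic F ∧ IsRegular F ∧ ∃ k : ℤ, HasLeadingTerm F (p + k)

end KRing

/-! ### Restriction of scalars from the punctured formal disks at `0` and `∞` to `𝔾ₘ` -/

/-- The inclusion `ℂ[x, x⁻¹]⟨∂⟩ → ℂ((x))⟨∂⟩`. -/
def inclZero : GmRing →ₐ[ℂ] KRing :=
  GmRing.lift (KRing.ofSeries (xpow 1)) (KRing.ofSeries (xpow (-1))) KRing.d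
    (by rw [← map_mul, xpow_mul]; exact map_one _)
    (by rw [← map_mul, xpow_mul]; exact map_one _)
    (by
      rw [KRing.d_mul_ofSeries, derivative_xpow]
      simp [xpow_zero])

/-- The inclusion of `ℂ[x, x⁻¹]⟨∂ₓ⟩` in the ring of differential operators `ℂ((y))⟨∂_y⟩` on the
punctured formal disk at `∞`, where `y = x⁻¹` is the coordinate at `∞`: it sends `x` to `y⁻¹` and
`∂ₓ` to `- y² ∂_y`. In particular `x ∂ₓ` goes to `- y ∂_y`. -/
def inclInfty : GmRing →ₐ[ℂ] KRing :=
  GmRing.lift (KRing.ofSeries (xpow (-1))) (KRing.ofSeries (xpow 1))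
    (-(KRing.ofSeries (xpow 2) * KRing.d))
    (by rw [← map_mul, xpow_mul]; exact map_one _)
    (by rw [← map_mul, xpow_mul]; exact map_one _)
    (by
      have h1 : xpow 2 * xpow (-1) = xpow (-1) * xpow 2 := mul_comm _ _
      have h2 : xpow 2 * (HahnSeries.C ((-1 : ℤ) : ℂ) * xpow (-1 - 1)) = -1 := by
        rw [mul_left_comm, xpow_mul]
        simp [xpow_zero]
      rw [neg_mul, mul_assoc, KRing.d_mul_ofSeries, derivative_xpow, mul_add, ← mul_assoc,
        ← map_mul, ← map_mul, h2, h1, map_mul, map_neg, map_one]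
      noncomm_ring)

/-- The forgetful functor from `ℂ((x))⟨∂⟩`-modules to `D`-modules on `𝔾ₘ`. -/
def forgetZero : ModuleCat.{u} KRing ⥤ ModuleCat.{u} GmRing :=
  ModuleCat.restrictScalars (inclZero : GmRing →+* KRing)

/-- The forgetful functor from `D`-modules on the punctured formal disk at `∞` to `D`-modules on
`𝔾ₘ`. -/
def forgetInfty : ModuleCat.{u} KRing ⥤ ModuleCat.{u} GmRing :=
  ModuleCat.restrictScalars (inclInfty : GmRing →+* KRing)

/-! ### Sections supported at a point, as `ℂ[[π]]`-modules -/

section LocNil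
variable {V : Type u} [AddCommGroup V] [Module ℂ V]

/-- The vectors killed by a power of the operator `T`. -/
def locNil (T : Module.End ℂ V) : Submodule ℂ V where
  carrier := {v | ∃ n : ℕ, (T ^ n) v = 0}
  zero_mem' := ⟨0, by simp⟩
  add_mem' := by
    rintro a b ⟨m, hm⟩ ⟨n, hn⟩
    refine ⟨m + n, ?_⟩
    rw [map_add, pow_add, Module.End.mul_apply, Module.End.mul_apply, hn, map_zero, add_zero,
      ← Module.End.mul_apply, ← pow_add, add_comm, pow_add, Module.End.mul_apply, hm, map_zero]
  smul_mem' := by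
    rintro c a ⟨m, hm⟩
    exact ⟨m, by rw [map_smul, hm, smul_zero]⟩

lemma aeval_congr (T : Module.End ℂ V) {n : ℕ} {v : V} (hv : (T ^ n) v = 0)
    {P Q : Polynomial ℂ} (h : Polynomial.X ^ n ∣ P - Q) :
    Polynomial.aeval T P v = Polynomial.aeval T Q v := by
  obtain ⟨R, hR⟩ := h
  have : P = R * Polynomial.X ^ n + Q := by rw [mul_comm, ← hR]; ring
  rw [this]
  simp [hv]

lemma aeval_mem_locNil (T : Module.End ℂ V) (P : Polynomial ℂ) {v : V} (hv : v ∈ locNil T) :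
    Polynomial.aeval T P v ∈ locNil T := by
  obtain ⟨n, hn⟩ := hv
  refine ⟨n, ?_⟩
  have : T ^ n * Polynomial.aeval T P = Polynomial.aeval T P * T ^ n := by
    rw [← Polynomial.aeval_X_pow (R := ℂ) (x := T), ← map_mul, ← map_mul, mul_comm]
  rw [← Module.End.mul_apply, this, Module.End.mul_apply, hn, map_zero]

open Classical in
/-- The action of a power series in a locally nilpotent operator `T`:
`(∑ aₖ πᵏ) • v = ∑_{k < n} aₖ Tᵏ v`, where `Tⁿ v = 0`. -/
def psSMul (T : Module.End ℂ V) (f : ℂ⟦X⟧) (v : locNil T) : locNil T :=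
  ⟨Polynomial.aeval T (PowerSeries.trunc (Nat.find v.2) f) v.1, aeval_mem_locNil T _ v.2⟩

lemma X_pow_dvd_of_coeff {P : Polynomial ℂ} {n : ℕ} {f g : ℂ⟦X⟧} (hfg : PowerSeries.X ^ n ∣ f - g)
    (hP : (P : ℂ⟦X⟧) = f - g) : Polynomial.X ^ n ∣ P := by
  rw [Polynomial.X_pow_dvd_iff]
  intro k hk
  rw [← Polynomial.coeff_coe, hP]
  exact PowerSeries.X_pow_dvd_iff.1 hfg k hk

lemma X_pow_dvd_sub_trunc (n : ℕ) (f : ℂ⟦X⟧) :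
    PowerSeries.X ^ n ∣ f - (PowerSeries.trunc n f : ℂ⟦X⟧) := by
  rw [PowerSeries.X_pow_dvd_iff]
  intro k hk
  rw [map_sub, Polynomial.coeff_coe, PowerSeries.coeff_trunc, if_pos hk, sub_self]

/-- Any polynomial congruent to `f` modulo `πⁿ` computes the action of `f` on a vector killed by
`Tⁿ`. -/
lemma psSMul_eq (T : Module.End ℂ V) (f : ℂ⟦X⟧) (v : locNil T) {n : ℕ} (hn : (T ^ n) v.1 = 0)
    {P : Polynomial ℂ} (hP : PowerSeries.X ^ n ∣ f - (P : ℂ⟦X⟧)) :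
    (psSMul T f v : V) = Polynomial.aeval T P v.1 := by
  classical
  have hle : Nat.find v.2 ≤ n := Nat.find_min' v.2 hn
  refine aeval_congr T (Nat.find_spec v.2) ?_
  refine X_pow_dvd_of_coeff (f := f - (P : ℂ⟦X⟧))
    (g := f - (PowerSeries.trunc (Nat.find v.2) f : ℂ⟦X⟧))
    (dvd_sub ((pow_dvd_pow _ hle).trans hP) (X_pow_dvd_sub_trunc _ _)) ?_
  rw [Polynomial.coe_sub]
  ring

/-- The space `locNil T` as a type. -/
def LocNil (T : Module.End ℂ V) : Type u := locNil T

instance (T : Module.End ℂ V) : AddCommGroup (LocNil T) := inferInstanceAs (AddCommGroup (locNil T))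

instance (T : Module.End ℂ V) : SMul ℂ⟦X⟧ (LocNil T) := ⟨psSMul T⟩

lemma LocNil.smul_val (T : Module.End ℂ V) (f : ℂ⟦X⟧) (v : LocNil T) {n : ℕ}
    (hn : (T ^ n) v.1 = 0) {P : Polynomial ℂ} (hP : PowerSeries.X ^ n ∣ f - (P : ℂ⟦X⟧)) :
    (f • v).1 = Polynomial.aeval T P v.1 := psSMul_eq T f v hn hP

/-- The vectors killed by a power of `T` form a `ℂ[[π]]`-module, with `π` acting as `T`. -/
instance (T : Module.End ℂ V) : Module ℂ⟦X⟧ (LocNil T) where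
  one_smul v := by
    obtain ⟨n, hn⟩ := v.2
    refine Subtype.ext ?_
    rw [LocNil.smul_val T 1 v hn (P := 1) (by simp)]
    simp
  mul_smul f g v := by
    obtain ⟨n, hn⟩ := v.2
    refine Subtype.ext ?_
    have hg := LocNil.smul_val T g v hn (X_pow_dvd_sub_trunc n g)
    have hn' : (T ^ n) (g • v).1 = 0 := by
      have : T ^ n * Polynomial.aeval T (PowerSeries.trunc n g)
          = Polynomial.aeval T (PowerSeries.trunc n g) * T ^ n := by
        rw [← Polynomial.aeval_X_pow (R := ℂ) (x := T), ← map_mul, ← map_mul, mul_comm]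
      rw [hg, ← Module.End.mul_apply, this, Module.End.mul_apply, hn, map_zero]
    rw [LocNil.smul_val T f (g • v) hn' (X_pow_dvd_sub_trunc n f), hg,
      LocNil.smul_val T (f * g) v hn
        (P := PowerSeries.trunc n f * PowerSeries.trunc n g) ?_, map_mul, Module.End.mul_apply]
    have h : f * g - ((PowerSeries.trunc n f * PowerSeries.trunc n g : Polynomial ℂ) : ℂ⟦X⟧)
        = (f - (PowerSeries.trunc n f : ℂ⟦X⟧)) * g
          + (PowerSeries.trunc n f : ℂ⟦X⟧) * (g - (PowerSeries.trunc n g : ℂ⟦X⟧)) := by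
      rw [Polynomial.coe_mul]; ring
    rw [h]
    exact dvd_add ((X_pow_dvd_sub_trunc n f).mul_right _) ((X_pow_dvd_sub_trunc n g).mul_left _)
  smul_zero f := by
    refine Subtype.ext ?_
    have h0 : (T ^ 0) ((0 : LocNil T).1) = 0 := by
      rw [pow_zero]; rfl
    rw [LocNil.smul_val T f 0 h0 (P := 0) (by simp)]
    simp only [map_zero, LinearMap.zero_apply]
    rfl
  smul_add f v w := by
    obtain ⟨m, hm⟩ := v.2
    obtain ⟨n, hn⟩ := w.2
    have hv : (T ^ (m + n)) v.1 = 0 := by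
      rw [add_comm, pow_add, Module.End.mul_apply, hm, map_zero]
    have hw : (T ^ (m + n)) w.1 = 0 := by
      rw [pow_add, Module.End.mul_apply, hn, map_zero]
    have hvw : (v + w).1 = v.1 + w.1 := rfl
    have hs : (T ^ (m + n)) (v + w).1 = 0 := by rw [hvw, map_add, hv, hw, add_zero]
    refine Subtype.ext ?_
    have : (f • v + f • w).1 = (f • v).1 + (f • w).1 := rfl
    rw [this, LocNil.smul_val T f _ hs (X_pow_dvd_sub_trunc _ f),
      LocNil.smul_val T f _ hv (X_pow_dvd_sub_trunc _ f),
      LocNil.smul_val T f _ hw (X_pow_dvd_sub_trunc _ f), hvw, map_add]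
  add_smul f g v := by
    obtain ⟨n, hn⟩ := v.2
    refine Subtype.ext ?_
    have : (f • v + g • v).1 = (f • v).1 + (g • v).1 := rfl
    rw [this, LocNil.smul_val T (f + g) v hn (P := PowerSeries.trunc n f + PowerSeries.trunc n g),
      LocNil.smul_val T f v hn (X_pow_dvd_sub_trunc _ f),
      LocNil.smul_val T g v hn (X_pow_dvd_sub_trunc _ g), map_add, LinearMap.add_apply]
    rw [Polynomial.coe_add, add_sub_add_comm]
    exact dvd_add (X_pow_dvd_sub_trunc n f) (X_pow_dvd_sub_trunc n g)
  zero_smul v := by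
    obtain ⟨n, hn⟩ := v.2
    refine Subtype.ext ?_
    rw [LocNil.smul_val T 0 v hn (P := 0) (by simp)]
    simp only [map_zero, LinearMap.zero_apply]
    rfl

/-- Functoriality of `LocNil` in operators. -/
def LocNil.map {W : Type u} [AddCommGroup W] [Module ℂ W] {T : Module.End ℂ V}
    {S : Module.End ℂ W} (φ : V →ₗ[ℂ] W) (h : ∀ v, φ (T v) = S (φ v)) :
    LocNil T →ₗ[ℂ⟦X⟧] LocNil S :=
  have hpow : ∀ (n : ℕ) (v : V), φ ((T ^ n) v) = (S ^ n) (φ v) := by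
    intro n
    induction n with
    | zero => intro v; simp
    | succ n ih => intro v; rw [pow_succ, Module.End.mul_apply, ih, h, pow_succ,
        Module.End.mul_apply]
  have hmem : ∀ {n : ℕ} {v : V}, (T ^ n) v = 0 → (S ^ n) (φ v) = 0 := by
    intro n v hv
    rw [← hpow, hv, map_zero]
  { toFun := fun v => ⟨φ v.1, v.2.imp fun _ hn => hmem hn⟩
    map_add' := fun v w => Subtype.ext (map_add φ v.1 w.1)
    map_smul' := fun f v => by
      obtain ⟨n, hn⟩ := v.2
      refine Subtype.ext ?_
      refine Eq.trans ?_ (LocNil.smul_val S f _ (hmem hn) (X_pow_dvd_sub_trunc n f)).symm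
      refine (congrArg φ (LocNil.smul_val T f v hn (X_pow_dvd_sub_trunc n f))).trans ?_
      rw [Polynomial.aeval_eq_sum_range,
        Polynomial.aeval_eq_sum_range]
      simp [LinearMap.sum_apply, map_sum, hpow] }

end LocNil

attribute [local instance] ModuleCat.moduleOfAlgebraModule
  ModuleCat.isScalarTower_of_algebra_moduleCat

/-- The operator `z - p` on a difference module. -/
def zSub (p : ℂ) (M : ModuleCat.{u} DiffRing) : Module.End ℂ M :=
  Algebra.lsmul ℂ ℂ M (DiffRing.z - algebraMap ℂ DiffRing p)

/-- Sections supported at `p` of a difference module `M`: the vectors killed by a power of `z - p`,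
as a module over `ℂ[[z - p]]`; the variable of the power series acts as `z - p`. -/
def supportedAt (p : ℂ) : ModuleCat.{u} DiffRing ⥤ ModuleCat.{u} ℂ⟦X⟧ where
  obj M := ModuleCat.of ℂ⟦X⟧ (LocNil (zSub p M))
  map {M N} φ := ModuleCat.ofHom (LocNil.map (T := zSub p M) (S := zSub p N)
    (φ.hom.restrictScalars ℂ)
    (fun v => φ.hom.map_smul (DiffRing.z - algebraMap ℂ DiffRing p) v))

/-- The local Mellin transform `𝓜^{(0, p + ℤ)}` before restriction to regular holonomic modules:
sections supported at `p` of the Mellin transform. -/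
def localMellinZero (p : ℂ) : ModuleCat.{u} KRing ⥤ ModuleCat.{u} ℂ⟦X⟧ :=
  forgetZero ⋙ mellin ⋙ supportedAt p

/-- The local Mellin transform `𝓜^{(∞, p + ℤ)}`. -/
def localMellinInfty (p : ℂ) : ModuleCat.{u} KRing ⥤ ModuleCat.{u} ℂ⟦X⟧ :=
  forgetInfty ⋙ mellin ⋙ supportedAt p

/-! ### The functors `N ↦ ℂ((τ)) ⊗ N` and `N ↦ ℂ((τ⁻¹)) ⊗ N` -/

instance : SMulCommClass ℂ (LaurentSeries ℂ) (LaurentSeries ℂ) where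
  smul_comm c f g := by
    simp only [smul_eq_mul, ← HahnSeries.C_mul_eq_smul]
    ring

instance : IsScalarTower ℂ (LaurentSeries ℂ) (LaurentSeries ℂ) where
  smul_assoc c f g := by
    simp only [smul_eq_mul, ← HahnSeries.C_mul_eq_smul]
    ring

/-- The Euler operator `X d/dX` on Laurent series. -/
def euler : LaurentSeries ℂ →ₗ[ℂ] LaurentSeries ℂ :=
  LinearMap.mulLeft ℂ (xpow 1) ∘ₗ LaurentSeries.derivative ℂ

lemma xpow_mul_coeff (m n : ℤ) (f : LaurentSeries ℂ) :
    (xpow m * f).coeff n = f.coeff (n - m) := by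
  have := HahnSeries.coeff_single_mul_add (r := (1 : ℂ)) (x := f) (a := n - m) (b := m)
  rw [sub_add_cancel, one_mul] at this
  exact this

lemma euler_coeff (f : LaurentSeries ℂ) (n : ℤ) : (euler f).coeff n = n * f.coeff n := by
  simp [euler, xpow_mul_coeff, LaurentSeries.derivative_apply, LaurentSeries.hasseDeriv_coeff]

lemma euler_xpow_mul (m : ℤ) (f : LaurentSeries ℂ) :
    euler (xpow m * f) = xpow m * euler f + (m : ℂ) • (xpow m * f) := by
  ext n
  simp only [euler_coeff, xpow_mul_coeff, HahnSeries.coeff_add, HahnSeries.coeff_smul, smul_eq_mul]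
  push_cast
  ring

section Iota

/-- The vector space `ℂ((X)) ⊗ N`. -/
def LaurentTensor (N : ModuleCat.{u} ℂ⟦X⟧) : Type u := LaurentSeries ℂ ⊗[ℂ] N

instance (N : ModuleCat.{u} ℂ⟦X⟧) : AddCommGroup (LaurentTensor N) :=
  inferInstanceAs (AddCommGroup (LaurentSeries ℂ ⊗[ℂ] N))

instance (N : ModuleCat.{u} ℂ⟦X⟧) : Module ℂ (LaurentTensor N) :=
  inferInstanceAs (Module ℂ (LaurentSeries ℂ ⊗[ℂ] N))

/-- `ℂ((X)) ⊗ N` is a vector space over `ℂ((X))`, which acts on the left factor. -/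
instance (N : ModuleCat.{u} ℂ⟦X⟧) : Module (LaurentSeries ℂ) (LaurentTensor N) :=
  inferInstanceAs (Module (LaurentSeries ℂ) (LaurentSeries ℂ ⊗[ℂ] N))

/-- `ℂ((X)) ⊗ N` is a module over `ℂ[[X]]`, which acts on the left factor. -/
instance (N : ModuleCat.{u} ℂ⟦X⟧) : Module ℂ⟦X⟧ (LaurentTensor N) :=
  Module.compHom (LaurentTensor N) (algebraMap ℂ⟦X⟧ (LaurentSeries ℂ))

/-- Pure tensors. -/
def LaurentTensor.tmul {N : ModuleCat.{u} ℂ⟦X⟧} (f : LaurentSeries ℂ) (v : N) : LaurentTensor N :=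
  f ⊗ₜ[ℂ] v

lemma LaurentTensor.hom_ext {N : ModuleCat.{u} ℂ⟦X⟧} {W : Type*} [AddCommGroup W] [Module ℂ W]
    {φ ψ : LaurentTensor N →ₗ[ℂ] W} (h : ∀ f v, φ (tmul f v) = ψ (tmul f v)) : φ = ψ :=
  TensorProduct.ext' h

lemma LaurentTensor.add_tmul {N : ModuleCat.{u} ℂ⟦X⟧} (f g : LaurentSeries ℂ) (v : N) :
    tmul (f + g) v = tmul f v + tmul g v := TensorProduct.add_tmul f g v

lemma LaurentTensor.smul_tmul {N : ModuleCat.{u} ℂ⟦X⟧} (c : ℂ) (f : LaurentSeries ℂ) (v : N) :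
    tmul (c • f) v = c • tmul f v := rfl

lemma LaurentTensor.power_smul_tmul {N : ModuleCat.{u} ℂ⟦X⟧} (a : ℂ⟦X⟧) (f : LaurentSeries ℂ)
    (v : N) :
    a • tmul f v = tmul (algebraMap ℂ⟦X⟧ (LaurentSeries ℂ) a * f) v := rfl

open LaurentTensor

/-- The map `1 ⊗ φ`. -/
def LaurentTensor.map {N N' : ModuleCat.{u} ℂ⟦X⟧} (φ : N ⟶ N') :
    LaurentTensor N →ₗ[ℂ] LaurentTensor N' :=
  (φ.hom.restrictScalars ℂ).lTensor (LaurentSeries ℂ)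

lemma LaurentTensor.map_tmul {N N' : ModuleCat.{u} ℂ⟦X⟧} (φ : N ⟶ N') (f : LaurentSeries ℂ)
    (v : N) : LaurentTensor.map φ (tmul f v) = tmul f (φ.hom v) := rfl

variable (p : ℂ) (N : ModuleCat.{u} ℂ⟦X⟧)

/-- The operator `p + π` on a `ℂ[[π]]`-module. -/
def zOp : Module.End ℂ N :=
  Algebra.lsmul ℂ ℂ N (algebraMap ℂ ℂ⟦X⟧ p + PowerSeries.X)

/-- Multiplication by `Xᵐ` on `ℂ((X)) ⊗ N`. -/
def shiftOp (m : ℤ) : Module.End ℂ (LaurentTensor N) :=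
  (LinearMap.mulLeft ℂ (xpow m)).rTensor N

/-- The operator `X d/dX ⊗ 1` on `ℂ((X)) ⊗ N`. -/
def eulerLeft : Module.End ℂ (LaurentTensor N) := euler.rTensor N

/-- The operator `1 ⊗ (p + π)` on `ℂ((X)) ⊗ N`. -/
def zRight : Module.End ℂ (LaurentTensor N) := (zOp p N).lTensor (LaurentSeries ℂ)

/-- The operator `ε X d/dX ⊗ 1 + 1 ⊗ (p + π)` on `ℂ((X)) ⊗ N`; for `ε = ± 1` and `X = τ ^ ε` it
is the action of `z`, determined by `z (τⁿ ⊗ m) = τⁿ (z + n) (1 ⊗ m) = τⁿ ⊗ (p + π + n) m`. -/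
def eulerOp (ε : ℤ) : Module.End ℂ (LaurentTensor N) :=
  (ε : ℂ) • eulerLeft N + zRight p N

lemma shiftOp_tmul (m : ℤ) (f : LaurentSeries ℂ) (v : N) :
    shiftOp N m (tmul f v) = tmul (xpow m * f) v := rfl

lemma eulerOp_tmul (ε : ℤ) (f : LaurentSeries ℂ) (v : N) :
    eulerOp p N ε (tmul f v) = (ε : ℂ) • tmul (euler f) v + tmul f (zOp p N v) := rfl

lemma shiftOp_mul (m n : ℤ) : shiftOp N m * shiftOp N n = shiftOp N (m + n) := by
  refine hom_ext fun f v => ?_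
  rw [Module.End.mul_apply, shiftOp_tmul, shiftOp_tmul, shiftOp_tmul, ← mul_assoc, xpow_mul]

lemma shiftOp_zero : shiftOp N 0 = 1 := by
  refine hom_ext fun f v => ?_
  rw [shiftOp_tmul, xpow_zero, one_mul, Module.End.one_apply]

lemma shiftOp_mul_eulerOp (ε : ℤ) (hε : ε * ε = 1) :
    shiftOp N ε * eulerOp p N ε = (eulerOp p N ε - 1) * shiftOp N ε := by
  have h : (ε : ℂ) * ε = 1 := by exact_mod_cast hε
  refine hom_ext fun f v => ?_
  rw [Module.End.mul_apply, Module.End.mul_apply, LinearMap.sub_apply, Module.End.one_apply,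
    eulerOp_tmul, map_add, map_smul, shiftOp_tmul, shiftOp_tmul, shiftOp_tmul, eulerOp_tmul,
    euler_xpow_mul, add_tmul, smul_add, smul_tmul, smul_smul, h, one_smul]
  abel

/-- The action of difference operators on `ℂ((X)) ⊗ N` with `X = τ ^ ε`, where `ε = ± 1`. -/
def iotaRep (ε : ℤ) (hε : ε * ε = 1) : DiffRing →ₐ[ℂ] Module.End ℂ (LaurentTensor N) :=
  DiffRing.lift (eulerOp p N ε) (shiftOp N ε) (shiftOp N (-ε))
    (by rw [shiftOp_mul, add_neg_cancel, shiftOp_zero])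
    (by rw [shiftOp_mul, neg_add_cancel, shiftOp_zero])
    (shiftOp_mul_eulerOp p N ε hε)

lemma iotaRep_map (ε : ℤ) (hε : ε * ε = 1) {N N' : ModuleCat.{u} ℂ⟦X⟧} (φ : N ⟶ N')
    (a : DiffRing) :
    LaurentTensor.map φ ∘ₗ iotaRep p N ε hε a = iotaRep p N' ε hε a ∘ₗ LaurentTensor.map φ := by
  refine DiffRing.induction (P := fun a =>
    LaurentTensor.map φ ∘ₗ iotaRep p N ε hε a = iotaRep p N' ε hε a ∘ₗ LaurentTensor.map φ)
    (fun c => ?_) ?_ ?_ ?_ (fun a b ha hb => ?_) (fun a b ha hb => ?_) a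
  · refine hom_ext fun f v => ?_
    rw [AlgHom.commutes, AlgHom.commutes, LinearMap.comp_apply, LinearMap.comp_apply,
      Module.algebraMap_end_apply, Module.algebraMap_end_apply, map_smul]
  · rw [iotaRep, iotaRep, DiffRing.lift_z, DiffRing.lift_z]
    refine hom_ext fun f v => ?_
    have h : φ.hom (zOp p N v) = zOp p N' (φ.hom v) :=
      φ.hom.map_smul (algebraMap ℂ ℂ⟦X⟧ p + PowerSeries.X) v
    rw [LinearMap.comp_apply, LinearMap.comp_apply, eulerOp_tmul, map_add, map_smul, map_tmul,
      map_tmul, map_tmul, eulerOp_tmul, h]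
  · rw [iotaRep, iotaRep, DiffRing.lift_t, DiffRing.lift_t]
    exact hom_ext fun f v => rfl
  · rw [iotaRep, iotaRep, DiffRing.lift_tinv, DiffRing.lift_tinv]
    exact hom_ext fun f v => rfl
  · rw [map_add, map_add, LinearMap.comp_add, LinearMap.add_comp, ha, hb]
  · rw [map_mul, map_mul, Module.End.mul_eq_comp, Module.End.mul_eq_comp, ← LinearMap.comp_assoc,
      ha, LinearMap.comp_assoc, hb, LinearMap.comp_assoc]

/-- The difference module `ℂ((X)) ⊗ N`, where `X = τ ^ ε`. -/
def iotaObj (ε : ℤ) (hε : ε * ε = 1) : ModuleCat.{u} DiffRing :=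
  letI : Module DiffRing (LaurentTensor N) :=
    Module.compHom (LaurentTensor N) (iotaRep p N ε hε).toRingHom
  ModuleCat.of DiffRing (LaurentTensor N)

end Iota

/-- The functor `N ↦ ℂ((X)) ⊗ N` from `ℂ[[z - p]]`-modules to difference modules, with
`X = τ ^ ε`, `ε = ± 1`; here `π = z - p` is the variable of the power series. -/
def iota (p : ℂ) (ε : ℤ) (hε : ε * ε = 1) : ModuleCat.{u} ℂ⟦X⟧ ⥤ ModuleCat.{u} DiffRing where
  obj N := iotaObj p N ε hε
  map {N N'} φ := ModuleCat.ofHom (X := iotaObj p N ε hε) (Y := iotaObj p N' ε hε)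
    { toFun := LaurentTensor.map φ
      map_add' := map_add (LaurentTensor.map φ)
      map_smul' := fun a v => LinearMap.congr_fun (iotaRep_map p ε hε φ a) v }
  map_id N := by
    ext v
    exact LinearMap.congr_fun (LinearMap.lTensor_id (LaurentSeries ℂ) N) v
  map_comp {N N' N''} φ ψ := by
    ext v
    exact LinearMap.congr_fun (LinearMap.lTensor_comp (LaurentSeries ℂ)
      (ψ.hom.restrictScalars ℂ) (φ.hom.restrictScalars ℂ)) v

/-- The `ℂ[[z - p]]`-modules of finite length. -/
def finLen : ObjectProperty (ModuleCat.{u} ℂ⟦X⟧) := fun N => IsFiniteLength ℂ⟦X⟧ N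

/-- The functor `ι_{p!}^→ : N ↦ ℂ((τ)) ⊗ N` on `ℂ[[z - p]]`-modules of finite length. -/
def iotaRight (p : ℂ) : (finLen.{u}).FullSubcategory ⥤ ModuleCat.{u} DiffRing :=
  finLen.ι ⋙ iota p 1 (by norm_num)

/-- The functor `ι_{p!}^← : N ↦ ℂ((τ⁻¹)) ⊗ N` on `ℂ[[z - p]]`-modules of finite length. -/
def iotaLeft (p : ℂ) : (finLen.{u}).FullSubcategory ⥤ ModuleCat.{u} DiffRing :=
  finLen.ι ⋙ iota p (-1) (by norm_num)

/-! ### The `τ`-adic topology -/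

section Topology
variable (V : Type u) [AddCommGroup V] [Module ℂ⟦X⟧ V]

/-- A `ℂ[[τ]]`-module is a complex vector space. -/
@[reducible] def complexModule : Module ℂ V := Module.compHom V (algebraMap ℂ ℂ⟦X⟧)

attribute [local instance] complexModule

variable {V} in
/-- A complex subspace `U` of a `ℂ[[τ]]`-module is open if for every finitely generated submodule
`N` there is `k` with `τᵏ N ⊆ U`. -/
def IsOpenSubspace (U : Submodule ℂ V) : Prop :=
  ∀ N : Submodule ℂ⟦X⟧ V, N.FG → ∃ k : ℕ, ∀ v ∈ N, (PowerSeries.X : ℂ⟦X⟧) ^ k • v ∈ U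

/-- The `τ`-adic topology on a `ℂ[[τ]]`-module: the open subspaces are a basis of neighbourhoods of
`0`. The variable of the power series is `τ`. -/
@[reducible] def adicTopology : TopologicalSpace V where
  IsOpen S := ∀ s ∈ S, ∃ U : Submodule ℂ V, IsOpenSubspace U ∧ ∀ v ∈ U, s + v ∈ S
  isOpen_univ := fun _ _ => ⟨⊤, fun _ _ => ⟨0, fun _ _ => trivial⟩, fun _ _ => trivial⟩
  isOpen_inter := by
    intro S S' hS hS' s hs
    obtain ⟨U, hU, hUS⟩ := hS s hs.1
    obtain ⟨U', hU', hUS'⟩ := hS' s hs.2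
    refine ⟨U ⊓ U', fun N hN => ?_, fun v hv => ⟨hUS v hv.1, hUS' v hv.2⟩⟩
    obtain ⟨k, hk⟩ := hU N hN
    obtain ⟨k', hk'⟩ := hU' N hN
    refine ⟨k + k', fun v hv => ⟨?_, ?_⟩⟩
    · rw [pow_add, mul_smul]
      exact hk _ (N.smul_mem _ hv)
    · rw [add_comm, pow_add, mul_smul]
      exact hk' _ (N.smul_mem _ hv)
  isOpen_sUnion := by
    intro 𝒮 h𝒮 s hs
    obtain ⟨S, hS, hsS⟩ := hs
    obtain ⟨U, hU, hUS⟩ := h𝒮 S hS s hsS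
    exact ⟨U, hU, fun v hv => ⟨S, hS, hUS v hv⟩⟩

end Topology

/-- A map from (the Mellin transform of) a `ℂ((x))⟨∂⟩`-module `F` to `ℂ((x)) ⊗ N` is a homeomorphism
for the `x`-adic topologies. Under the Mellin transform, the variable `x` is `τ` at the point `0`,
and it is `τ⁻¹` at the point `∞`. -/
def IsAdicHomeo {F : ModuleCat.{u} KRing} {N : ModuleCat.{u} ℂ⟦X⟧}
    (f : F → LaurentTensor N) : Prop :=
  letI : Module ℂ⟦X⟧ F := KRing.powerModule F
  @IsHomeomorph F (LaurentTensor N) (adicTopology F) (adicTopology (LaurentTensor N)) f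

/-- A functorial isomorphism `𝓜(j_{0*} F) ≅ ι_{p!}^→ (G F)` which is a homeomorphism for the
`τ`-adic topologies, for a given functor `G`. -/
def RepresentsZero (p : ℂ)
    (G : (KRing.regHol.{u} p).FullSubcategory ⥤ (finLen.{u}).FullSubcategory) : Prop :=
  ∃ α : (KRing.regHol.{u} p).ι ⋙ forgetZero ⋙ mellin ≅ G ⋙ iotaRight p,
    ∀ F, IsAdicHomeo (F := F.obj) (N := (G.obj F).obj) (fun v => (α.hom.app F).hom v)

/-- A functorial isomorphism `𝓜(j_{∞*} F) ≅ ι_{p!}^← (G F)` which is a homeomorphism for the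
`τ⁻¹`-adic topologies, for a given functor `G`. -/
def RepresentsInfty (p : ℂ)
    (G : (KRing.regHol.{u} (-p)).FullSubcategory ⥤ (finLen.{u}).FullSubcategory) : Prop :=
  ∃ α : (KRing.regHol.{u} (-p)).ι ⋙ forgetInfty ⋙ mellin ≅ G ⋙ iotaLeft p,
    ∀ F, IsAdicHomeo (F := F.obj) (N := (G.obj F).obj) (fun v => (α.hom.app F).hom v)

/-- The local Mellin transform `𝓜^{(0, p + ℤ)}` as a functor from regular holonomic
`ℂ((x))⟨∂⟩`-modules with leading term in `p + ℤ` to `ℂ[[z - p]]`-modules of finite length, given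
that it takes values in the latter. -/
def mellinFunctorZero (p : ℂ)
    (h : ∀ F : (KRing.regHol.{u} p).FullSubcategory, finLen ((localMellinZero p).obj F.obj)) :
    (KRing.regHol.{u} p).FullSubcategory ⥤ (finLen.{u}).FullSubcategory :=
  finLen.lift ((KRing.regHol p).ι ⋙ localMellinZero p) h

/-- The local Mellin transform `𝓜^{(∞, p + ℤ)}` as a functor from regular holonomic `D`-modules on
the punctured formal disk at `∞` with leading term in `-p + ℤ` to `ℂ[[z - p]]`-modules of finite
length, given that it takes values in the latter. -/
def mellinFunctorInfty (p : ℂ)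
    (h : ∀ F : (KRing.regHol.{u} (-p)).FullSubcategory, finLen ((localMellinInfty p).obj F.obj)) :
    (KRing.regHol.{u} (-p)).FullSubcategory ⥤ (finLen.{u}).FullSubcategory :=
  finLen.lift ((KRing.regHol (-p)).ι ⋙ localMellinInfty p) h

end LocalMellin

end

/-!
The statement is proved once for both points: with `ε = 1` at `0` and `ε = -1` at `∞`, a module `F`
over `ℂ((X))⟨∂⟩` becomes a difference module on which `τ` acts as `X ^ ε` and `z` as `ε X ∂`.
The hypothesis on `F` then says that, after multiplication by a power of `X`, there is a lattice `L`
stable under `A = z - p` with `Aⁿ L ⊆ X L`.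

The heart of the proof is that such an `F` is `ℂ((X)) ⊗ N`, where `N` consists of the vectors killed
by a power of `A`. On `Xᵐ L / Xᵐ⁺¹ L` the only eigenvalue of `A` is `ε m`, so the eigenvalue `0`
occurs exactly once in the `X`-adic filtration. Hence `N` is contained in `L` and meets `X L` in `0`
(`IsNilLattice.mem_of_pow_apply_eq_zero`, `IsNilLattice.eq_zero_of_eq_X_smul`), and successive
approximation lifts every class of `L / X L` to `N` (`IsNilLattice.exists_lift`). By Nakayama's
lemma `N` spans `F`, and a `ℂ`-basis of `N` stays independent over `ℂ((X))`
(`IsNilLattice.span_locNil`, `IsNilLattice.linearIndependent`). So the multiplication map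
`ℂ((X)) ⊗ N → F` is bijective; it is linear over difference operators and over `ℂ[[X]]`, and the
latter makes it a homeomorphism for the adic topologies.

Conversely, in `ℂ((X)) ⊗ N` the operator `z - p` acts on the coefficient of `Xⁿ` as `ε n + π`, which
is invertible in `ℂ[[π]]` for `n ≠ 0`; so the sections supported at `p` are `1 ⊗ N` (`unitIso`).
This gives essential surjectivity, since `ℂ((X)) ⊗ N` is regular with the required leading term
(`regHol_kObj`), and it recovers `G(F)` from `ℂ((X)) ⊗ G(F)`, which is the uniqueness assertion.
Full faithfulness follows because a map between spaces of sections extends to `ℂ((X)) ⊗ N`, and a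
map commuting with Laurent series and with `X ∂` is linear over `ℂ((X))⟨∂⟩`.
-/

noncomputable section

namespace LocalMellin

set_option linter.unusedSectionVars false

attribute [local instance] ModuleCat.moduleOfAlgebraModule
  ModuleCat.isScalarTower_of_algebra_moduleCat

/-! ### Power series and Laurent series -/

lemma euler_powerSeries (a : ℂ⟦X⟧) :
    euler (algebraMap ℂ⟦X⟧ (LaurentSeries ℂ) a) =
      algebraMap ℂ⟦X⟧ (LaurentSeries ℂ) (PowerSeries.X * PowerSeries.derivative ℂ a) := by
  ext n
  rw [euler_coeff]
  rcases lt_or_ge n 0 with hn | hn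
  · have h (b : ℂ⟦X⟧) : (algebraMap ℂ⟦X⟧ (LaurentSeries ℂ) b).coeff n = 0 := by
      rw [LaurentSeries.coe_algebraMap, PowerSeries.coeff_coe, if_pos hn]
    rw [h, h, mul_zero]
  · lift n to ℕ using hn
    rw [LaurentSeries.coe_algebraMap, LaurentSeries.coeff_coe_powerSeries,
      LaurentSeries.coeff_coe_powerSeries]
    cases n with
    | zero => simp
    | succ n =>
      rw [PowerSeries.coeff_succ_X_mul, PowerSeries.coeff_derivative]
      push_cast
      ring

lemma algebraMap_X_pow (m : ℕ) :
    algebraMap ℂ⟦X⟧ (LaurentSeries ℂ) (PowerSeries.X ^ m) = xpow m := by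
  rw [LaurentSeries.coe_algebraMap, HahnSeries.ofPowerSeries_X_pow, xpow]

lemma algebraMap_C (c : ℂ) :
    algebraMap ℂ⟦X⟧ (LaurentSeries ℂ) (PowerSeries.C c) = HahnSeries.C c := by
  rw [LaurentSeries.coe_algebraMap, HahnSeries.ofPowerSeries_C]

lemma euler_one : euler 1 = 0 := by
  ext n
  rw [euler_coeff, HahnSeries.coeff_one, HahnSeries.coeff_zero]
  split_ifs with hn <;> simp [hn]

lemma euler_xpow (m : ℤ) : euler (xpow m) = (m : ℂ) • xpow m := by
  have h := euler_xpow_mul m 1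
  rwa [euler_one, mul_zero, zero_add, mul_one] at h

/-- Completeness of `ℂ[[X]]`: the series `∑ Xⁱ aᵢ` converges `X`-adically. -/
lemma exists_powerSeries_sum (a : ℕ → ℂ⟦X⟧) :
    ∃ f : ℂ⟦X⟧, ∀ m, PowerSeries.X ^ m ∣ f - ∑ i ∈ Finset.range m, PowerSeries.X ^ i * a i := by
  refine ⟨PowerSeries.mk fun k =>
    PowerSeries.coeff k (∑ i ∈ Finset.range (k + 1), PowerSeries.X ^ i * a i), fun m => ?_⟩
  rw [PowerSeries.X_pow_dvd_iff]
  intro k hk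
  rw [map_sub, PowerSeries.coeff_mk, sub_eq_zero, map_sum, map_sum]
  refine Finset.sum_subset (Finset.range_mono hk) fun i _ hi => ?_
  rw [PowerSeries.coeff_X_pow_mul', if_neg]
  rw [Finset.mem_range] at hi
  omega

/-! ### Lattices on which a twisted Euler operator is nilpotent modulo `X` -/

section Core
variable {V : Type u} [AddCommGroup V] [Module ℂ V] [Module (LaurentSeries ℂ) V] [Module ℂ⟦X⟧ V]

/-- The operator `A` satisfies the Leibniz rule with respect to `ε X d/dX`. -/
def IsEulerOp (ε : ℂ) (A : Module.End ℂ V) : Prop :=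
  ∀ (f : LaurentSeries ℂ) (v : V), A (f • v) = (ε • euler f) • v + f • A v

/-- A lattice `L` which is stable under `A`, with `Aⁿ L ⊆ X L`. -/
structure IsNilLattice (A : Module.End ℂ V) (n : ℕ) (L : Submodule ℂ⟦X⟧ V) : Prop where
  fg : L.FG
  span : Submodule.span (LaurentSeries ℂ) (L : Set V) = ⊤
  stable : ∀ v ∈ L, A v ∈ L
  nil : ∀ v ∈ L, ∃ w ∈ L, (A ^ n) v = (PowerSeries.X : ℂ⟦X⟧) • w

variable [IsScalarTower ℂ (LaurentSeries ℂ) V] [IsScalarTower ℂ⟦X⟧ (LaurentSeries ℂ) V]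

lemma X_pow_smul_eq (m : ℕ) (v : V) : (PowerSeries.X : ℂ⟦X⟧) ^ m • v = xpow m • v := by
  rw [← algebraMap_X_pow, algebraMap_smul]

lemma C_smul_eq (c : ℂ) (v : V) : PowerSeries.C c • v = c • v := by
  have h : c • (1 : LaurentSeries ℂ) • v = (c • (1 : LaurentSeries ℂ)) • v :=
    (smul_assoc _ _ _).symm
  rw [one_smul, ← HahnSeries.C_mul_eq_smul, mul_one] at h
  rw [← algebraMap_smul (LaurentSeries ℂ), algebraMap_C, h]

lemma complex_smul_mem (L : Submodule ℂ⟦X⟧ V) (c : ℂ) {v : V} (hv : v ∈ L) : c • v ∈ L := by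
  rw [← C_smul_eq]
  exact L.smul_mem _ hv

lemma xpow_smul_injective (a : ℤ) : Function.Injective fun v : V => xpow a • v := by
  intro v w h
  have := congrArg (fun v => xpow (-a) • v) h
  simpa [smul_smul, xpow_mul, xpow_zero] using this

lemma X_smul_injective : Function.Injective fun v : V => (PowerSeries.X : ℂ⟦X⟧) • v := by
  intro v w h
  refine xpow_smul_injective ((1 : ℕ) : ℤ) ?_
  simpa only [← X_pow_smul_eq, pow_one] using h

lemma complex_smul_smul_comm (c : ℂ) (f : LaurentSeries ℂ) (v : V) : f • c • v = c • f • v := by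
  rw [← C_smul_eq, ← C_smul_eq, ← algebraMap_smul (LaurentSeries ℂ) (PowerSeries.C c) v,
    ← algebraMap_smul (LaurentSeries ℂ) (PowerSeries.C c) (f • v), smul_smul, smul_smul, mul_comm]

variable {ε : ℂ} {A : Module.End ℂ V}

/-- Commuting a twisted Euler operator past `Xᵐ` shifts it by `ε m`. -/
lemma IsEulerOp.pow_xpow_smul (hA : IsEulerOp ε A) (m : ℤ) (c : ℂ) (j : ℕ) (v : V) :
    ((A + c • (1 : Module.End ℂ V)) ^ j) (xpow m • v) =
      xpow m • ((A + (c + ε * m) • (1 : Module.End ℂ V)) ^ j) v := by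
  induction j generalizing v with
  | zero => simp
  | succ j ih =>
    rw [pow_succ, Module.End.mul_apply, pow_succ, Module.End.mul_apply, ← ih]
    congr 1
    rw [LinearMap.add_apply, hA, euler_xpow, smul_smul, LinearMap.add_apply, smul_add,
      LinearMap.smul_apply, LinearMap.smul_apply, Module.End.one_apply, Module.End.one_apply,
      smul_assoc, add_smul, smul_add, complex_smul_smul_comm, complex_smul_smul_comm]
    abel

omit [Module (LaurentSeries ℂ) V] [Module ℂ⟦X⟧ V] [IsScalarTower ℂ (LaurentSeries ℂ) V]
  [IsScalarTower ℂ⟦X⟧ (LaurentSeries ℂ) V] in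
lemma aeval_X_add_C_pow (A : Module.End ℂ V) (c : ℂ) (j : ℕ) :
    Polynomial.aeval A ((Polynomial.X + Polynomial.C c) ^ j) =
      (A + c • (1 : Module.End ℂ V)) ^ j := by
  rw [map_pow, map_add, Polynomial.aeval_X, Polynomial.aeval_C, Algebra.algebraMap_eq_smul_one]

namespace IsNilLattice
variable {n : ℕ} {L : Submodule ℂ⟦X⟧ V}

lemma aeval_mem (hL : IsNilLattice A n L) (P : Polynomial ℂ) {v : V} (hv : v ∈ L) :
    Polynomial.aeval A P v ∈ L := by
  induction P using Polynomial.induction_on' with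
  | add P Q hP hQ => rw [map_add]; exact L.add_mem hP hQ
  | monomial k c =>
    have h : (A ^ k) v ∈ L := by
      induction k with
      | zero => simpa using hv
      | succ k ih => rw [pow_succ', Module.End.mul_apply]; exact hL.stable _ ih
    rw [Polynomial.aeval_monomial, Module.End.mul_apply, Module.algebraMap_end_apply]
    exact complex_smul_mem L c h

lemma aeval_X_smul (hA : IsEulerOp ε A) (hL : IsNilLattice A n L) (P : Polynomial ℂ) {v : V}
    (hv : v ∈ L) (m : ℕ) :
    ∃ w ∈ L, Polynomial.aeval A P ((PowerSeries.X : ℂ⟦X⟧) ^ m • v) =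
      (PowerSeries.X : ℂ⟦X⟧) ^ m • w := by
  induction P using Polynomial.induction_on' with
  | add P Q hP hQ =>
    obtain ⟨w, hw, h⟩ := hP
    obtain ⟨w', hw', h'⟩ := hQ
    exact ⟨w + w', L.add_mem hw hw', by rw [map_add, LinearMap.add_apply, h, h', smul_add]⟩
  | monomial k c =>
    have h : ((A ^ k) ((PowerSeries.X : ℂ⟦X⟧) ^ m • v)) = (PowerSeries.X : ℂ⟦X⟧) ^ m •
        ((A + (ε * m) • (1 : Module.End ℂ V)) ^ k) v := by
      have := hA.pow_xpow_smul m 0 k v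
      rw [zero_smul, add_zero, zero_add] at this
      rw [X_pow_smul_eq, X_pow_smul_eq, this]
      norm_cast
    refine ⟨c • ((A + (ε * m) • (1 : Module.End ℂ V)) ^ k) v, complex_smul_mem L c ?_, ?_⟩
    · have := hL.aeval_mem ((Polynomial.X + Polynomial.C (ε * m)) ^ k) hv
      rwa [aeval_X_add_C_pow] at this
    · rw [Polynomial.aeval_monomial, Module.End.mul_apply, Module.algebraMap_end_apply, h,
        X_pow_smul_eq, X_pow_smul_eq, complex_smul_smul_comm]

/-- For `c ≠ 0` the operator `(A + c)ʲ` is surjective on `L / X L`, where `A` is nilpotent: a Bézout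
relation between `Tⁿ` and `(T + c)ʲ` gives a preimage `u' = b(A) u`, and being a polynomial in `A`
applied to `u`, it is killed by `(A + c)ʲ` if `u` is. -/
lemma exists_eq_pow_add (hA : IsEulerOp ε A) (hL : IsNilLattice A n L) {c : ℂ} (hc : c ≠ 0) (j : ℕ)
    {u : V} (hu : u ∈ L) :
    ∃ u' ∈ L, ∃ r ∈ L, u = ((A + c • (1 : Module.End ℂ V)) ^ j) u' + (PowerSeries.X : ℂ⟦X⟧) • r ∧
      (((A + c • (1 : Module.End ℂ V)) ^ j) u = 0 →
        ((A + c • (1 : Module.End ℂ V)) ^ j) u' = 0) := by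
  have hcop : IsCoprime ((Polynomial.X : Polynomial ℂ) ^ n)
      ((Polynomial.X + Polynomial.C c) ^ j) := by
    refine IsCoprime.pow ?_
    simpa using Polynomial.isCoprime_X_sub_C_of_isUnit_sub (a := (0 : ℂ)) (b := -c) (by simpa)
  obtain ⟨a, b, hab⟩ := hcop
  have hS := aeval_X_add_C_pow A c j
  obtain ⟨w, hw, hnw⟩ := hL.nil u hu
  obtain ⟨r, hr, har⟩ := hL.aeval_X_smul hA a hw 1
  rw [pow_one] at har
  refine ⟨Polynomial.aeval A b u, hL.aeval_mem b hu, r, hr, ?_, fun h => ?_⟩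
  · have := congrArg (fun P => Polynomial.aeval A P u) hab
    simp only [map_add, map_mul, LinearMap.add_apply, Module.End.mul_apply, map_one,
      Module.End.one_apply, Polynomial.aeval_X_pow, hnw, har, hS] at this
    refine this.symm.trans ?_
    rw [add_comm, ← hS, ← Module.End.mul_apply, ← Module.End.mul_apply, ← map_mul, ← map_mul,
      mul_comm]
  · rw [← hS] at h ⊢
    rw [← Module.End.mul_apply, ← map_mul, mul_comm, map_mul, Module.End.mul_apply, h, map_zero]

/-- An eigenvalue different from `0` does not occur in `L / X L`. -/
lemma exists_eq_X_smul (hA : IsEulerOp ε A) (hL : IsNilLattice A n L) {c : ℂ} (hc : c ≠ 0) {j : ℕ}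
    {v : V} (hv : v ∈ L) (h : ((A + c • (1 : Module.End ℂ V)) ^ j) v = 0) :
    ∃ w ∈ L, v = (PowerSeries.X : ℂ⟦X⟧) • w := by
  obtain ⟨u', -, r, hr, he, h0⟩ := hL.exists_eq_pow_add hA hc j hv
  exact ⟨r, hr, by rw [he, h0 h, zero_add]⟩

/-- The lattice spans: every vector is brought into it by a power of `X`. -/
lemma exists_X_pow_smul_mem (hL : IsNilLattice A n L) (v : V) :
    ∃ m : ℕ, (PowerSeries.X : ℂ⟦X⟧) ^ m • v ∈ L := by
  have hv : v ∈ Submodule.span (LaurentSeries ℂ) (L : Set V) := hL.span ▸ Submodule.mem_top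
  induction hv using Submodule.span_induction with
  | mem v hv => exact ⟨0, by simpa using hv⟩
  | zero => exact ⟨0, by simp⟩
  | add v w _ _ h h' =>
    obtain ⟨m, hm⟩ := h
    obtain ⟨m', hm'⟩ := h'
    refine ⟨m + m', ?_⟩
    rw [smul_add]
    refine L.add_mem ?_ ?_
    · rw [pow_add, mul_comm, mul_smul]
      exact L.smul_mem _ hm
    · rw [pow_add, mul_smul]
      exact L.smul_mem _ hm'
  | smul f v _ h =>
    obtain ⟨m, hm⟩ := h
    obtain ⟨⟨g, ⟨_, k, rfl⟩⟩, hg⟩ :=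
      IsLocalization.surj (Submonoid.powers (PowerSeries.X : ℂ⟦X⟧)) f
    refine ⟨k + m, ?_⟩
    have h : (PowerSeries.X : ℂ⟦X⟧) ^ (k + m) • f • v = g • (PowerSeries.X : ℂ⟦X⟧) ^ m • v := by
      rw [← algebraMap_smul (LaurentSeries ℂ), ← algebraMap_smul (LaurentSeries ℂ) g,
        ← algebraMap_smul (LaurentSeries ℂ) (PowerSeries.X ^ m : ℂ⟦X⟧), smul_smul, smul_smul, ← hg,
        pow_add, map_mul]
      congr 1
      ring
    rw [h]
    exact L.smul_mem g hm

/-- Generalized eigenvectors of eigenvalue `0` lie in the lattice. -/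
lemma mem_of_pow_apply_eq_zero (hε : ε ≠ 0) (hA : IsEulerOp ε A) (hL : IsNilLattice A n L) {j : ℕ}
    {v : V} (hv : (A ^ j) v = 0) : v ∈ L := by
  obtain ⟨m, hm⟩ := hL.exists_X_pow_smul_mem v
  induction m with
  | zero => simpa using hm
  | succ m ih =>
    have hc : -(ε * ((m + 1 : ℕ) : ℤ)) ≠ 0 := by
      rw [neg_ne_zero]
      exact mul_ne_zero hε (by norm_cast)
    have h0 := hA.pow_xpow_smul ((m + 1 : ℕ) : ℤ) (-(ε * ((m + 1 : ℕ) : ℤ))) j v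
    rw [neg_add_cancel, zero_smul, add_zero, hv, smul_zero, ← X_pow_smul_eq] at h0
    obtain ⟨w, hw, h⟩ := hL.exists_eq_X_smul hA hc hm h0
    rw [pow_succ', mul_smul] at h
    exact ih (X_smul_injective h ▸ hw)

/-- A lattice is `X`-adically separated, by Krull's intersection theorem. -/
lemma eq_zero_of_forall (hL : IsNilLattice A n L) {v : V}
    (h : ∀ m : ℕ, ∃ w ∈ L, v = (PowerSeries.X : ℂ⟦X⟧) ^ (m + 1) • w) : v = 0 := by
  have : Module.Finite ℂ⟦X⟧ L := Module.Finite.iff_fg.2 hL.fg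
  have hvL : v ∈ L := by
    obtain ⟨w, hw, rfl⟩ := h 0
    exact L.smul_mem _ hw
  have hI := Ideal.iInf_pow_smul_eq_bot_of_isLocalRing (M := L)
    (IsLocalRing.maximalIdeal ℂ⟦X⟧) (Ideal.IsPrime.ne_top')
  have hmem : (⟨v, hvL⟩ : L) ∈
      (⨅ i : ℕ, IsLocalRing.maximalIdeal ℂ⟦X⟧ ^ i • ⊤ : Submodule ℂ⟦X⟧ L) := by
    rw [Submodule.mem_iInf]
    intro i
    obtain ⟨w, hw, h⟩ := h i
    have : (⟨v, hvL⟩ : L) =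
        (PowerSeries.X : ℂ⟦X⟧) ^ i • ⟨(PowerSeries.X : ℂ⟦X⟧) • w, L.smul_mem _ hw⟩ :=
      Subtype.ext (h.trans (by rw [pow_succ, mul_smul]; rfl))
    rw [this]
    refine Submodule.smul_mem_smul (Ideal.pow_mem_pow ?_ i) Submodule.mem_top
    rw [PowerSeries.maximalIdeal_eq_span_X]
    exact Ideal.mem_span_singleton_self _
  rw [hI] at hmem
  exact congrArg Subtype.val ((Submodule.mem_bot _).1 hmem)

/-- The generalized eigenspace of eigenvalue `0` meets `X L` in `0`. -/
lemma eq_zero_of_eq_X_smul (hε : ε ≠ 0) (hA : IsEulerOp ε A) (hL : IsNilLattice A n L) {j : ℕ}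
    {v : V} (hv : (A ^ j) v = 0) (hX : ∃ w ∈ L, v = (PowerSeries.X : ℂ⟦X⟧) • w) : v = 0 := by
  have key : ∀ m : ℕ, ∃ w ∈ L, v = (PowerSeries.X : ℂ⟦X⟧) ^ (m + 1) • w := by
    intro m
    induction m with
    | zero => simpa using hX
    | succ m ih =>
      obtain ⟨w, hw, rfl⟩ := ih
      have h0 := hA.pow_xpow_smul ((m + 1 : ℕ) : ℤ) 0 j w
      rw [zero_smul, add_zero, ← X_pow_smul_eq, hv, zero_add] at h0
      have h1 := xpow_smul_injective _ ((smul_zero _).trans h0)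
      obtain ⟨w', hw', rfl⟩ := hL.exists_eq_X_smul hA
        (mul_ne_zero hε (by norm_cast)) hw h1.symm
      exact ⟨w', hw', by rw [smul_smul, ← pow_succ]⟩
  exact hL.eq_zero_of_forall key

/-- A series `∑ Xⁱ uᵢ` with terms in a finitely generated submodule converges `X`-adically. -/
lemma exists_sum (hL : IsNilLattice A n L) (u : ℕ → V) (hu : ∀ i, u i ∈ L) :
    ∃ s ∈ L, ∀ m : ℕ, ∃ r ∈ L, s - ∑ i ∈ Finset.range m, (PowerSeries.X : ℂ⟦X⟧) ^ i • u i =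
      (PowerSeries.X : ℂ⟦X⟧) ^ m • r := by
  obtain ⟨k, g, hg⟩ := Submodule.fg_iff_exists_fin_generating_family.1 hL.fg
  have hgL (j) : g j ∈ L := hg ▸ Submodule.subset_span ⟨j, rfl⟩
  have hmem (i) : ∃ a : Fin k → ℂ⟦X⟧, ∑ j, a j • g j = u i :=
    (Submodule.mem_span_range_iff_exists_fun _).1 (hg ▸ hu i)
  choose a ha using hmem
  choose f hf using fun j => exists_powerSeries_sum fun i => a i j
  refine ⟨∑ j, f j • g j, L.sum_mem fun j _ => L.smul_mem _ (hgL j), fun m => ?_⟩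
  choose b hb using fun j => hf j m
  refine ⟨∑ j, b j • g j, L.sum_mem fun j _ => L.smul_mem _ (hgL j), ?_⟩
  have h1 : ∑ i ∈ Finset.range m, (PowerSeries.X : ℂ⟦X⟧) ^ i • u i =
      ∑ j, (∑ i ∈ Finset.range m, PowerSeries.X ^ i * a i j) • g j := by
    simp only [← ha, Finset.smul_sum, Finset.sum_smul, smul_smul]
    exact Finset.sum_comm
  rw [h1, ← Finset.sum_sub_distrib, Finset.smul_sum]
  exact Finset.sum_congr rfl fun j _ => by rw [← sub_smul, hb, mul_smul]

/-- Vectors of `L / X L` lift to generalized eigenvectors of eigenvalue `0`. -/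
lemma exists_lift (hε : ε ≠ 0) (hA : IsEulerOp ε A) (hL : IsNilLattice A n L) {v : V} (hv : v ∈ L) :
    ∃ w, (A ^ n) w = 0 ∧ ∃ u ∈ L, v = w + (PowerSeries.X : ℂ⟦X⟧) • u := by
  -- Approximations `w` of the lift, with `Aⁿ w` in `Xᵐ⁺¹ L`; the next one differs by an element of
  -- `Xᵐ⁺¹ L`, on which `A` is `ε (m + 1)` plus a nilpotent operator modulo `X`.
  let S (m : ℕ) : Type u :=
    {w : V // w ∈ L ∧ ∃ u ∈ L, (A ^ n) w = (PowerSeries.X : ℂ⟦X⟧) ^ (m + 1) • u}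
  have step (m : ℕ) (w : S m) : ∃ u' ∈ L,
      w.1 - (PowerSeries.X : ℂ⟦X⟧) ^ (m + 1) • u' ∈ L ∧ ∃ u ∈ L,
      (A ^ n) (w.1 - (PowerSeries.X : ℂ⟦X⟧) ^ (m + 1) • u') =
        (PowerSeries.X : ℂ⟦X⟧) ^ (m + 1 + 1) • u := by
    obtain ⟨w, hw, u, hu, h⟩ := w
    obtain ⟨u', hu', r, hr, hur, -⟩ := hL.exists_eq_pow_add hA (c := ε * ((m + 1 : ℕ) : ℤ))
      (mul_ne_zero hε (by norm_cast)) n hu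
    refine ⟨u', hu', L.sub_mem hw (L.smul_mem _ hu'), r, hr, ?_⟩
    have h0 := hA.pow_xpow_smul ((m + 1 : ℕ) : ℤ) 0 n u'
    rw [zero_smul, add_zero, zero_add, ← X_pow_smul_eq, ← X_pow_smul_eq] at h0
    rw [map_sub, h, h0, ← smul_sub, hur, add_sub_cancel_left, smul_smul, ← pow_succ]
  choose g hgL hgw hg using step
  let σ : ∀ m, S m := fun m => Nat.rec (motive := S)
    ⟨v, hv, by simpa using hL.nil v hv⟩
    (fun m w => ⟨w.1 - (PowerSeries.X : ℂ⟦X⟧) ^ (m + 1) • g m w, hgw m w, hg m w⟩) m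
  have hσ (m : ℕ) : (σ m).1 = v - (PowerSeries.X : ℂ⟦X⟧) •
      ∑ i ∈ Finset.range m, (PowerSeries.X : ℂ⟦X⟧) ^ i • g i (σ i) := by
    induction m with
    | zero => simp [σ]
    | succ m ih =>
      have : (σ (m + 1)).1 = (σ m).1 - (PowerSeries.X : ℂ⟦X⟧) ^ (m + 1) • g m (σ m) := rfl
      rw [this, ih, Finset.sum_range_succ, smul_add, sub_sub, pow_succ', mul_smul]
  obtain ⟨s, hs, hsum⟩ := hL.exists_sum (fun i => g i (σ i)) fun i => hgL i _
  refine ⟨v - (PowerSeries.X : ℂ⟦X⟧) • s, ?_, s, hs, by rw [sub_add_cancel]⟩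
  refine hL.eq_zero_of_forall fun m => ?_
  obtain ⟨r, hr, h⟩ := hsum m
  obtain ⟨u, hu, hw⟩ := (σ m).2.2
  obtain ⟨r', hr', h'⟩ := hL.aeval_X_smul hA (Polynomial.X ^ n) hr (m + 1)
  rw [Polynomial.aeval_X_pow] at h'
  refine ⟨u - r', L.sub_mem hu hr', ?_⟩
  have : v - (PowerSeries.X : ℂ⟦X⟧) • s = (σ m).1 - (PowerSeries.X : ℂ⟦X⟧) ^ (m + 1) • r := by
    have hp : (PowerSeries.X : ℂ⟦X⟧) ^ (m + 1) • r =
        (PowerSeries.X : ℂ⟦X⟧) • (PowerSeries.X : ℂ⟦X⟧) ^ m • r := by rw [pow_succ', mul_smul]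
    rw [hσ, hp, ← h, smul_sub]
    abel
  rw [this, map_sub, hw, h', smul_sub]

/-- The generalized eigenspace of eigenvalue `0` generates the lattice, by Nakayama's lemma, and so
it spans the whole space. -/
lemma span_locNil (hε : ε ≠ 0) (hA : IsEulerOp ε A) (hL : IsNilLattice A n L) :
    Submodule.span (LaurentSeries ℂ) (locNil A : Set V) = ⊤ := by
  have h : L ≤ Submodule.span ℂ⟦X⟧ (locNil A : Set V) := by
    refine Submodule.le_of_le_smul_of_le_jacobson_bot hL.fg
      (IsLocalRing.maximalIdeal_le_jacobson ⊥) fun v hv => ?_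
    obtain ⟨w, hw, u, hu, rfl⟩ := hL.exists_lift hε hA hv
    refine Submodule.add_mem_sup (Submodule.subset_span ⟨n, hw⟩) (Submodule.smul_mem_smul ?_ hu)
    rw [PowerSeries.maximalIdeal_eq_span_X]
    exact Ideal.mem_span_singleton_self _
  rw [eq_top_iff, ← hL.span, Submodule.span_le]
  exact h.trans (Submodule.span_le_restrictScalars ℂ⟦X⟧ (LaurentSeries ℂ) _)

/-- Vectors in the generalized eigenspace of eigenvalue `0` which are independent over `ℂ` are
independent over `ℂ((X))`. -/
lemma linearIndependent (hε : ε ≠ 0) (hA : IsEulerOp ε A) (hL : IsNilLattice A n L) {ι : Type*}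
    {v : ι → V} (hv : ∀ i, v i ∈ locNil A) (hi : LinearIndependent ℂ v) :
    LinearIndependent (LaurentSeries ℂ) v := by
  have hvL (i) : v i ∈ L := (hv i).elim fun j hj => hL.mem_of_pow_apply_eq_zero hε hA hj
  rw [linearIndependent_iff'] at hi ⊢
  intro s
  -- A relation over `ℂ[[X]]` has zero constant terms, so it is divisible by `X`.
  have key (m : ℕ) : ∀ g : ι → ℂ⟦X⟧, ∑ i ∈ s, g i • v i = 0 →
      ∀ i ∈ s, PowerSeries.X ^ m ∣ g i := by
    induction m with
    | zero => simp
    | succ m ih =>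
      intro g hg
      have hdvd (i) : ∃ g', g i =
          PowerSeries.X * g' + PowerSeries.C (PowerSeries.constantCoeff (g i)) :=
        ⟨_, PowerSeries.eq_X_mul_shift_add_const _⟩
      choose g' hg' using hdvd
      have h0 : ∑ i ∈ s, PowerSeries.constantCoeff (g i) • v i = 0 := by
        have hmem : ∑ i ∈ s, PowerSeries.constantCoeff (g i) • v i ∈ locNil A :=
          Submodule.sum_mem _ fun i _ => Submodule.smul_mem _ _ (hv i)
        obtain ⟨j, hj⟩ := hmem
        refine hL.eq_zero_of_eq_X_smul hε hA hj ⟨-∑ i ∈ s, g' i • v i,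
          L.neg_mem (L.sum_mem fun i _ => L.smul_mem _ (hvL i)), ?_⟩
        rw [smul_neg, eq_neg_iff_add_eq_zero, Finset.smul_sum, ← Finset.sum_add_distrib]
        refine Eq.trans (Finset.sum_congr rfl fun i _ => ?_) hg
        conv_rhs => rw [hg' i]
        rw [add_smul, mul_smul, C_smul_eq, add_comm]
      have hc := hi s _ h0
      have hg'' : ∀ i ∈ s, g i = PowerSeries.X * g' i := fun i his => by
        conv_lhs => rw [hg' i, hc i his]
        rw [map_zero, add_zero]
      have h1 : ∑ i ∈ s, g' i • v i = 0 := by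
        refine X_smul_injective ?_
        simp only [smul_zero]
        rw [← hg, Finset.smul_sum]
        exact Finset.sum_congr rfl fun i his => by rw [hg'' i his, mul_smul]
      intro i his
      rw [hg'' i his, pow_succ']
      exact mul_dvd_mul_left _ (ih g' h1 i his)
  intro f hf i his
  obtain ⟨b, hb⟩ := IsLocalization.exist_integer_multiples (nonZeroDivisors ℂ⟦X⟧) s f
  choose! g hg using hb
  have hg0 : ∑ i ∈ s, g i • v i = 0 := by
    have := congrArg (fun v => (b : ℂ⟦X⟧) • v) hf
    simp only [smul_zero, Finset.smul_sum] at this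
    rw [← this]
    refine Finset.sum_congr rfl fun i his => ?_
    rw [← algebraMap_smul (LaurentSeries ℂ), hg i his, smul_assoc]
  have hgi : g i = 0 := by
    ext k
    rw [map_zero]
    exact PowerSeries.X_pow_dvd_iff.1 (key (k + 1) g hg0 i his) k k.lt_succ_self
  have := hg i his
  rw [hgi, map_zero, Algebra.smul_def, eq_comm, mul_eq_zero] at this
  exact this.resolve_left ((map_ne_zero_iff _ (IsFractionRing.injective ℂ⟦X⟧ (LaurentSeries ℂ))).2
    (nonZeroDivisors.ne_zero b.2))

end IsNilLattice
end Core

/-! ### Modules of finite length over `ℂ[[π]]` -/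

section FiniteLength

lemma exists_X_pow_smul_eq_zero {M : Type*} [AddCommGroup M] [Module ℂ⟦X⟧ M]
    (h : IsFiniteLength ℂ⟦X⟧ M) : ∃ n : ℕ, ∀ v : M, (PowerSeries.X : ℂ⟦X⟧) ^ n • v = 0 := by
  induction h with
  | of_subsingleton => exact ⟨0, fun v => Subsingleton.elim _ _⟩
  | @of_simple_quotient M _ _ N _ _ ih =>
    obtain ⟨n, hn⟩ := ih
    have hX : (PowerSeries.X : ℂ⟦X⟧) ∈ Module.annihilator ℂ⟦X⟧ (M ⧸ N) := by
      have := IsSimpleModule.annihilator_isMaximal (R := ℂ⟦X⟧) (M := M ⧸ N)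
      rw [IsLocalRing.eq_maximalIdeal this, PowerSeries.maximalIdeal_eq_span_X]
      exact Ideal.mem_span_singleton_self _
    refine ⟨n + 1, fun v => ?_⟩
    have hv : (PowerSeries.X : ℂ⟦X⟧) • v ∈ N := by
      rw [← Submodule.Quotient.mk_eq_zero, Submodule.Quotient.mk_smul]
      exact Module.mem_annihilator.1 hX _
    rw [pow_succ, mul_smul]
    exact congrArg Subtype.val (hn ⟨_, hv⟩)

/-- A power series acts on a vector killed by `Xⁿ` through its first `n` coefficients. -/
lemma smul_eq_sum_of_X_pow_smul_eq_zero {M : Type*} [AddCommGroup M] [Module ℂ⟦X⟧ M]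
    {n : ℕ} {v : M} (hv : (PowerSeries.X : ℂ⟦X⟧) ^ n • v = 0) (f : ℂ⟦X⟧) :
    f • v = ∑ j ∈ Finset.range n,
      PowerSeries.C (PowerSeries.coeff j f) • (PowerSeries.X : ℂ⟦X⟧) ^ j • v := by
  have hdvd : PowerSeries.X ^ n ∣
      f - ∑ j ∈ Finset.range n, PowerSeries.C (PowerSeries.coeff j f) * PowerSeries.X ^ j := by
    rw [PowerSeries.X_pow_dvd_iff]
    intro k hk
    simp only [map_sub, map_sum, PowerSeries.coeff_C_mul, PowerSeries.coeff_X_pow,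
      mul_ite, mul_one, mul_zero, Finset.sum_ite_eq, Finset.mem_range, hk, if_true, sub_self]
  obtain ⟨g, hg⟩ := hdvd
  rw [sub_eq_iff_eq_add] at hg
  conv_lhs => rw [hg, add_smul, mul_comm, mul_smul, hv, smul_zero, zero_add, Finset.sum_smul]
  exact Finset.sum_congr rfl fun j _ => mul_smul _ _ _

/-- An additive map which commutes with scalars and with `X` commutes with power series on vectors
killed by a power of `X`. -/
lemma map_powerSeries_smul {M M' : Type*} [AddCommGroup M] [Module ℂ⟦X⟧ M] [AddCommGroup M']
    [Module ℂ⟦X⟧ M'] (φ : M →+ M')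
    (hX : ∀ v : M, φ ((PowerSeries.X : ℂ⟦X⟧) • v) = (PowerSeries.X : ℂ⟦X⟧) • φ v)
    (hC : ∀ (c : ℂ) (v : M), φ (PowerSeries.C c • v) = PowerSeries.C c • φ v)
    {n : ℕ} {v : M} (hv : (PowerSeries.X : ℂ⟦X⟧) ^ n • v = 0) (f : ℂ⟦X⟧) :
    φ (f • v) = f • φ v := by
  have hpow (j : ℕ) : φ ((PowerSeries.X : ℂ⟦X⟧) ^ j • v) = (PowerSeries.X : ℂ⟦X⟧) ^ j • φ v := by
    induction j with
    | zero => simp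
    | succ j ih => rw [pow_succ', mul_smul, hX, ih, mul_smul]
  have hv' : (PowerSeries.X : ℂ⟦X⟧) ^ n • φ v = 0 := by rw [← hpow, hv, map_zero]
  rw [smul_eq_sum_of_X_pow_smul_eq_zero hv, smul_eq_sum_of_X_pow_smul_eq_zero hv', map_sum]
  exact Finset.sum_congr rfl fun j _ => by rw [hC, hpow]

lemma finite_complex_of_isFiniteLength {M : Type*} [AddCommGroup M] [Module ℂ⟦X⟧ M] [Module ℂ M]
    [IsScalarTower ℂ ℂ⟦X⟧ M] (h : IsFiniteLength ℂ⟦X⟧ M) : Module.Finite ℂ M := by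
  obtain ⟨n, hn⟩ := exists_X_pow_smul_eq_zero h
  have := (isFiniteLength_iff_isNoetherian_isArtinian.1 h).1
  obtain ⟨S, hS⟩ := Module.Finite.fg_top (R := ℂ⟦X⟧) (M := M)
  let T : Set M := Set.image2 (fun (j : ℕ) s => (PowerSeries.X : ℂ⟦X⟧) ^ j • s) (Set.Iio n) S
  have hT : T.Finite := (Set.finite_Iio n).image2 _ S.finite_toSet
  refine ⟨Submodule.fg_def.2 ⟨T, hT, ?_⟩⟩
  have hX (v : M) (hv : v ∈ Submodule.span ℂ T) (k : ℕ) :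
      (PowerSeries.X : ℂ⟦X⟧) ^ k • v ∈ Submodule.span ℂ T := by
    induction hv using Submodule.span_induction with
    | mem v hv =>
      obtain ⟨j, -, s, hs, rfl⟩ := hv
      simp only [smul_smul, ← pow_add]
      rcases lt_or_ge (k + j) n with hlt | hge
      · exact Submodule.subset_span ⟨k + j, hlt, s, hs, rfl⟩
      · rw [← Nat.sub_add_cancel hge, pow_add, mul_smul, hn, smul_zero]
        exact Submodule.zero_mem _
    | zero => simp
    | add v w _ _ h h' => rw [smul_add]; exact Submodule.add_mem _ h h'
    | smul c v _ h => rw [smul_comm]; exact Submodule.smul_mem _ c h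
  rw [eq_top_iff]
  rintro v -
  have hv : v ∈ Submodule.span ℂ⟦X⟧ (S : Set M) := hS ▸ Submodule.mem_top
  induction hv using Submodule.span_induction with
  | mem v hv =>
    rcases Nat.eq_zero_or_pos n with rfl | h0
    · have := hn v
      rw [pow_zero, one_smul] at this
      simp [this]
    · exact Submodule.subset_span ⟨0, h0, v, hv, by simp⟩
  | zero => exact Submodule.zero_mem _
  | add v w _ _ h h' => exact Submodule.add_mem _ h h'
  | smul f v _ h =>
    rw [smul_eq_sum_of_X_pow_smul_eq_zero (hn v)]
    refine Submodule.sum_mem _ fun j _ => ?_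
    have hc (c : ℂ) (w : M) : PowerSeries.C c • w = c • w := algebraMap_smul ℂ⟦X⟧ c w
    rw [hc]
    exact Submodule.smul_mem _ _ (hX v h j)

end FiniteLength

section LocNil
variable {V : Type u} [AddCommGroup V] [Module ℂ V] (T : Module.End ℂ V)

lemma LocNil.X_smul_val (v : LocNil T) : ((PowerSeries.X : ℂ⟦X⟧) • v).1 = T v.1 := by
  obtain ⟨n, hn⟩ := v.2
  rw [LocNil.smul_val T _ v hn (P := Polynomial.X) (by simp), Polynomial.aeval_X]

lemma LocNil.C_smul_val (c : ℂ) (v : LocNil T) : (PowerSeries.C c • v).1 = c • v.1 := by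
  obtain ⟨n, hn⟩ := v.2
  rw [LocNil.smul_val T _ v hn (P := Polynomial.C c) (by simp), Polynomial.aeval_C,
    Module.algebraMap_end_apply]

lemma isFiniteLength_locNil [Module.Finite ℂ (locNil T)] : IsFiniteLength ℂ⟦X⟧ (LocNil T) := by
  let : Module ℂ (LocNil T) := inferInstanceAs (Module ℂ (locNil T))
  have : Module.Finite ℂ (LocNil T) := inferInstanceAs (Module.Finite ℂ (locNil T))
  have : IsScalarTower ℂ ℂ⟦X⟧ (LocNil T) := ⟨fun c f v => by
    rw [PowerSeries.smul_eq_C_mul, mul_smul]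
    exact Subtype.ext (LocNil.C_smul_val T c _)⟩
  exact isFiniteLength_iff_isNoetherian_isArtinian.2
    ⟨isNoetherian_of_tower ℂ inferInstance, isArtinian_of_tower ℂ inferInstance⟩

end LocNil

/-! ### The multiplication map `ℂ((X)) ⊗ N → V` -/

lemma LaurentTensor.exists_sum_basis {N : ModuleCat.{u} ℂ⟦X⟧} {ι : Type*}
    (b : Module.Basis ι ℂ N) (t : LaurentTensor N) :
    ∃ c : ι →₀ LaurentSeries ℂ, t = c.sum fun i f => tmul f (b i) := by
  obtain ⟨c, hc⟩ := TensorProduct.eq_repr_basis_right b (M := LaurentSeries ℂ) t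
  exact ⟨c, hc.symm⟩

lemma LaurentTensor.smul_tmul_left {N : ModuleCat.{u} ℂ⟦X⟧} (f g : LaurentSeries ℂ) (v : N) :
    f • tmul g v = tmul (f * g) v := rfl

lemma LaurentTensor.induction {N : ModuleCat.{u} ℂ⟦X⟧} {P : LaurentTensor N → Prop}
    (h : ∀ f v, P (tmul f v)) (hadd : ∀ s t, P s → P t → P (s + t)) (t : LaurentTensor N) :
    P t := by
  refine TensorProduct.induction_on t ?_ h hadd
  have := h 0 0
  rwa [tmul, TensorProduct.tmul_zero] at this

section Mult
variable {V : Type u} [AddCommGroup V] [Module ℂ V] [Module (LaurentSeries ℂ) V] [Module ℂ⟦X⟧ V]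
  [IsScalarTower ℂ (LaurentSeries ℂ) V] [IsScalarTower ℂ⟦X⟧ (LaurentSeries ℂ) V]
  {N : ModuleCat.{u} ℂ⟦X⟧}

/-- The map `f ⊗ v ↦ f φ(v)` extending a linear map `φ : N → V` to a `ℂ((X))`-vector space `V`. -/
def extend (φ : N →ₗ[ℂ] V) : LaurentTensor N →ₗ[ℂ] V :=
  TensorProduct.lift (LinearMap.mk₂ ℂ (fun (f : LaurentSeries ℂ) (v : N) => f • φ v)
    (fun f g v => add_smul f g _) (fun c f v => smul_assoc c f _)
    (fun f v w => by rw [map_add, smul_add])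
    (fun c f v => by rw [map_smul, complex_smul_smul_comm]))

lemma extend_tmul (φ : N →ₗ[ℂ] V) (f : LaurentSeries ℂ) (v : N) :
    extend φ (LaurentTensor.tmul f v) = f • φ v := rfl

lemma extend_smul (φ : N →ₗ[ℂ] V) (f : LaurentSeries ℂ) (t : LaurentTensor N) :
    extend φ (f • t) = f • extend φ t := by
  induction t using LaurentTensor.induction with
  | h g v => rw [LaurentTensor.smul_tmul_left, extend_tmul, extend_tmul, mul_smul]
  | hadd s t hs ht => rw [smul_add, map_add, map_add, smul_add, hs, ht]

/-- A vector space with a nilpotent lattice is `ℂ((X)) ⊗ N`, where `N` is the generalized eigenspace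
of eigenvalue `0`. -/
lemma IsNilLattice.extend_bijective {ε : ℂ} {A : Module.End ℂ V} {n : ℕ} {L : Submodule ℂ⟦X⟧ V}
    (hε : ε ≠ 0) (hA : IsEulerOp ε A) (hL : IsNilLattice A n L) (φ : N →ₗ[ℂ] V)
    (hinj : Function.Injective φ) (hmem : ∀ v, φ v ∈ locNil A)
    (hsurj : ∀ w ∈ locNil A, ∃ v, φ v = w) : Function.Bijective (extend φ) := by
  constructor
  · rw [injective_iff_map_eq_zero]
    intro t ht
    let b := Module.Basis.ofVectorSpace ℂ N
    obtain ⟨c, rfl⟩ := LaurentTensor.exists_sum_basis b t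
    have hi := hL.linearIndependent hε hA (v := fun i => φ (b i)) (fun i => hmem _)
      (b.linearIndependent.map' φ (LinearMap.ker_eq_bot.2 hinj))
    have hc : c = 0 := by
      refine linearIndependent_iff.1 hi c ?_
      rw [Finsupp.linearCombination_apply]
      rwa [Finsupp.sum, map_sum] at ht
    rw [hc, Finsupp.sum_zero_index]
  · intro v
    have hv : v ∈ Submodule.span (LaurentSeries ℂ) (locNil A : Set V) :=
      hL.span_locNil hε hA ▸ Submodule.mem_top
    induction hv using Submodule.span_induction with
    | mem v hv =>
      obtain ⟨w, rfl⟩ := hsurj v hv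
      exact ⟨LaurentTensor.tmul 1 w, by rw [extend_tmul, one_smul]⟩
    | zero => exact ⟨0, map_zero _⟩
    | add v w _ _ h h' =>
      obtain ⟨s, rfl⟩ := h
      obtain ⟨t, rfl⟩ := h'
      exact ⟨s + t, map_add _ _ _⟩
    | smul f v _ h =>
      obtain ⟨t, rfl⟩ := h
      exact ⟨f • t, extend_smul φ f t⟩

/-- The generalized eigenspace is finite dimensional, since its dimension over `ℂ` is at most the
dimension of the whole space over `ℂ((X))`. -/
lemma IsNilLattice.finite_locNil {ε : ℂ} {A : Module.End ℂ V} {n : ℕ} {L : Submodule ℂ⟦X⟧ V}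
    (hε : ε ≠ 0) (hA : IsEulerOp ε A) (hL : IsNilLattice A n L)
    [Module.Finite (LaurentSeries ℂ) V] : Module.Finite ℂ (locNil A) := by
  let b := Module.Basis.ofVectorSpace ℂ (locNil A)
  have hi := hL.linearIndependent hε hA (v := fun i => (b i : V)) (fun i => (b i).2)
    (b.linearIndependent.map' (locNil A).subtype (Submodule.ker_subtype _))
  have := hi.finite
  exact Module.Finite.of_basis b

end Mult

/-! ### Linear bijections are homeomorphisms for the adic topologies -/

lemma isHomeomorph_adic {V W : Type u} [AddCommGroup V] [Module ℂ⟦X⟧ V] [AddCommGroup W]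
    [Module ℂ⟦X⟧ W] (e : V ≃ₗ[ℂ⟦X⟧] W) :
    @IsHomeomorph V W (adicTopology V) (adicTopology W) e := by
  have key {V W : Type u} [AddCommGroup V] [Module ℂ⟦X⟧ V] [AddCommGroup W] [Module ℂ⟦X⟧ W]
      (e : V →ₗ[ℂ⟦X⟧] W) : @Continuous V W (adicTopology V) (adicTopology W) e := by
    let := adicTopology V
    let := adicTopology W
    refine ⟨fun S hS s hs => ?_⟩
    obtain ⟨U, hU, hUS⟩ := hS (e s) hs
    let := complexModule V
    let := complexModule W
    let e' : V →ₗ[ℂ] W := { e with map_smul' := fun c v => e.map_smul (algebraMap ℂ ℂ⟦X⟧ c) v }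
    refine ⟨U.comap e', fun N hN => ?_, fun v hv => ?_⟩
    · obtain ⟨k, hk⟩ := hU (N.map e) (hN.map e)
      refine ⟨k, fun v hv => ?_⟩
      have := hk (e v) ⟨v, hv, rfl⟩
      rw [← map_smul] at this
      exact this
    · have := hUS (e v) hv
      rwa [← map_add] at this
  let := adicTopology V
  let := adicTopology W
  exact (Homeomorph.mk e.toEquiv (key e.toLinearMap) (key e.symm.toLinearMap)).isHomeomorph

/-! ### Sections supported at `p` of `ℂ((X)) ⊗ N` -/

section Unit
variable (p : ℂ) (ε : ℤ) (hε : ε * ε = 1)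

/-- The operator `ε X d/dX ⊗ 1 + 1 ⊗ π` on `ℂ((X)) ⊗ N`, which is the action of `z - p`. -/
def zSubTensor (N : ModuleCat.{u} ℂ⟦X⟧) : Module.End ℂ (LaurentTensor N) :=
  eulerOp p N ε - p • (1 : Module.End ℂ (LaurentTensor N))

lemma zSubTensor_tmul {N : ModuleCat.{u} ℂ⟦X⟧} (f : LaurentSeries ℂ) (v : N) :
    zSubTensor p ε N (LaurentTensor.tmul f v) =
      (ε : ℂ) • LaurentTensor.tmul (euler f) v +
        LaurentTensor.tmul f ((PowerSeries.X : ℂ⟦X⟧) • v) := by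
  have hz : zOp p N v = p • v + (PowerSeries.X : ℂ⟦X⟧) • v := by
    rw [← algebraMap_smul ℂ⟦X⟧ p v, ← add_smul]
    rfl
  have ht : LaurentTensor.tmul f (zOp p N v) = p • LaurentTensor.tmul f v +
      LaurentTensor.tmul f ((PowerSeries.X : ℂ⟦X⟧) • v) := by
    rw [hz]
    exact (TensorProduct.tmul_add _ _ _).trans
      (congrArg (· + _) (TensorProduct.tmul_smul p f v))
  rw [zSubTensor, LinearMap.sub_apply, LinearMap.smul_apply, Module.End.one_apply, eulerOp_tmul, ht]
  abel

/-- The two sides live on types with different, though equal, complex structures; so the comparison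
is between values. -/
lemma zSub_iota_pow {N : ModuleCat.{u} ℂ⟦X⟧} (j : ℕ) (t : LaurentTensor N) :
    (zSub p ((iota p ε hε).obj N) ^ j) t = (zSubTensor p ε N ^ j) t := by
  have h : (zSub p ((iota p ε hε).obj N) : LaurentTensor N → LaurentTensor N) =
      zSubTensor p ε N := by
    have h : iotaRep p N ε hε (DiffRing.z - algebraMap ℂ DiffRing p) = zSubTensor p ε N := by
      rw [map_sub, AlgHom.commutes, iotaRep, DiffRing.lift_z, Algebra.algebraMap_eq_smul_one]
      rfl
    rw [← h]
    rfl
  rw [Module.End.pow_apply, ← h]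
  exact Module.End.pow_apply _ _ _

/-- The coefficient of `Xⁿ` of a Laurent series with coefficients in `N`. -/
def coeffTensor (N : ModuleCat.{u} ℂ⟦X⟧) (n : ℤ) : LaurentTensor N →ₗ[ℂ] N :=
  TensorProduct.lift (LinearMap.mk₂ ℂ (fun (f : LaurentSeries ℂ) (v : N) => f.coeff n • v)
    (fun f g v => by rw [HahnSeries.coeff_add, add_smul])
    (fun c f v => by rw [HahnSeries.coeff_smul, smul_assoc])
    (fun f v w => smul_add _ _ _)
    (fun c f v => smul_comm _ _ _))

lemma coeffTensor_tmul {N : ModuleCat.{u} ℂ⟦X⟧} (n : ℤ) (f : LaurentSeries ℂ) (v : N) :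
    coeffTensor N n (LaurentTensor.tmul f v) = f.coeff n • v := rfl

/-- The coefficients are jointly injective: in terms of a basis of `N` they are the coefficients of
finitely many Laurent series. -/
lemma tensor_ext {N : ModuleCat.{u} ℂ⟦X⟧} {s t : LaurentTensor N}
    (h : ∀ n, coeffTensor N n s = coeffTensor N n t) : s = t := by
  rw [← sub_eq_zero]
  have h' (n : ℤ) : coeffTensor N n (s - t) = 0 := by rw [map_sub, h, sub_self]
  generalize s - t = r at h'
  let b := Module.Basis.ofVectorSpace ℂ N
  obtain ⟨c, rfl⟩ := LaurentTensor.exists_sum_basis b r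
  have hc : c = 0 := by
    ext i n
    have h0 := h' n
    rw [Finsupp.sum, map_sum] at h0
    by_cases hi : i ∈ c.support
    · exact linearIndependent_iff'.1 b.linearIndependent c.support (fun i => (c i).coeff n) h0 i hi
    · rw [Finsupp.notMem_support_iff.1 hi]
      rfl
  rw [hc, Finsupp.sum_zero_index]

lemma coeffTensor_zSubTensor {N : ModuleCat.{u} ℂ⟦X⟧} (n : ℤ) (t : LaurentTensor N) :
    coeffTensor N n (zSubTensor p ε N t) =
      (PowerSeries.C ((ε : ℂ) * n) + PowerSeries.X : ℂ⟦X⟧) • coeffTensor N n t := by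
  induction t using LaurentTensor.induction with
  | h f v =>
    rw [zSubTensor_tmul, map_add, map_smul, coeffTensor_tmul, coeffTensor_tmul, coeffTensor_tmul,
      euler_coeff, add_smul]
    congr 1
    · rw [smul_smul, ← mul_assoc, mul_smul]
      exact (algebraMap_smul ℂ⟦X⟧ _ _).symm
    · exact smul_comm _ _ _
  | hadd s t hs ht =>
    rw [map_add, map_add, map_add, smul_add, hs, ht]

lemma coeffTensor_zSubTensor_pow {N : ModuleCat.{u} ℂ⟦X⟧} (n : ℤ) (j : ℕ) (t : LaurentTensor N) :
    coeffTensor N n ((zSubTensor p ε N ^ j) t) =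
      (PowerSeries.C ((ε : ℂ) * n) + PowerSeries.X : ℂ⟦X⟧) ^ j • coeffTensor N n t := by
  induction j with
  | zero => rw [pow_zero, pow_zero, one_smul]; rfl
  | succ j ih =>
    rw [pow_succ', Module.End.mul_apply, pow_succ', mul_smul, ← ih]
    exact coeffTensor_zSubTensor p ε n _

lemma zSubTensor_pow_one_tmul {N : ModuleCat.{u} ℂ⟦X⟧} (j : ℕ) (v : N) :
    (zSubTensor p ε N ^ j) (LaurentTensor.tmul 1 v) =
      LaurentTensor.tmul 1 ((PowerSeries.X : ℂ⟦X⟧) ^ j • v) := by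
  induction j generalizing v with
  | zero => rw [pow_zero, pow_zero, one_smul]; rfl
  | succ j ih =>
    rw [pow_succ, Module.End.mul_apply, zSubTensor_tmul, euler_one, pow_succ, mul_smul, ← ih]
    have : LaurentTensor.tmul (0 : LaurentSeries ℂ) v = 0 := TensorProduct.zero_tmul _ _
    rw [this, smul_zero, zero_add]

/-- A generalized eigenvector for `z - p` in `ℂ((X)) ⊗ N` is constant: for `n ≠ 0` the power
series `ε n + π` is invertible, so the coefficient of `Xⁿ` vanishes. -/
lemma eq_one_tmul_of_zSubTensor_pow (hε0 : ε ≠ 0) {N : ModuleCat.{u} ℂ⟦X⟧} {j : ℕ}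
    {t : LaurentTensor N} (h : (zSubTensor p ε N ^ j) t = 0) :
    t = LaurentTensor.tmul 1 (coeffTensor N 0 t) := by
  refine tensor_ext fun n => ?_
  rw [coeffTensor_tmul, HahnSeries.coeff_one]
  split_ifs with hn
  · rw [hn, one_smul]
  · have h0 := coeffTensor_zSubTensor_pow p ε n j t
    rw [h] at h0
    have hu : IsUnit ((PowerSeries.C ((ε : ℂ) * n) + PowerSeries.X : ℂ⟦X⟧) ^ j) := by
      refine IsUnit.pow j (PowerSeries.isUnit_iff_constantCoeff.2 ?_)
      simp [hε0, hn]
    rw [zero_smul, ← hu.smul_eq_zero, ← h0]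
    exact map_zero (coeffTensor N n)

/-- The vectors `1 ⊗ v` are exactly the sections supported at `p` of `ℂ((X)) ⊗ N`. -/
def unitEquiv (N : ModuleCat.{u} ℂ⟦X⟧) (hN : IsFiniteLength ℂ⟦X⟧ N) :
    N ≃ₗ[ℂ⟦X⟧] (supportedAt p).obj ((iota p ε hε).obj N) :=
  let φ : N →+ LocNil (zSub p ((iota p ε hε).obj N)) :=
    { toFun := fun v => ⟨LaurentTensor.tmul 1 v, by
        obtain ⟨n, hn⟩ := exists_X_pow_smul_eq_zero hN
        refine ⟨n, (zSub_iota_pow p ε hε n _).trans ?_⟩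
        rw [zSubTensor_pow_one_tmul, hn]
        exact TensorProduct.tmul_zero _ _⟩
      map_zero' := Subtype.ext (TensorProduct.tmul_zero _ _)
      map_add' := fun v w => Subtype.ext (TensorProduct.tmul_add _ _ _) }
  { φ with
    invFun := fun t => coeffTensor N 0 t.1
    left_inv := fun v => by
      refine (coeffTensor_tmul 0 1 v).trans ?_
      rw [HahnSeries.coeff_one, if_pos rfl, one_smul]
    right_inv := fun t => by
      obtain ⟨j, hj⟩ := t.2
      refine Subtype.ext (eq_one_tmul_of_zSubTensor_pow p ε ?_
        ((zSub_iota_pow p ε hε j _).symm.trans hj)).symm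
      rintro rfl
      simp at hε
    map_smul' := fun f v => by
      obtain ⟨n, hn⟩ := exists_X_pow_smul_eq_zero hN
      refine map_powerSeries_smul φ (fun v => Subtype.ext ?_) (fun c v => Subtype.ext ?_) (hn v) f
      · refine Eq.trans ?_ (LocNil.X_smul_val _ (φ v)).symm
        have h := zSub_iota_pow p ε hε 1 (LaurentTensor.tmul 1 v)
        rw [zSubTensor_pow_one_tmul, pow_one, pow_one] at h
        exact h.symm
      · refine Eq.trans ?_ (LocNil.C_smul_val _ c (φ v)).symm
        have h2 : PowerSeries.C c • v = c • v := algebraMap_smul ℂ⟦X⟧ c v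
        refine Eq.trans ?_
          (algebraMap_smul DiffRing c (φ v).1)
        change _ = iotaRep p N ε hε (algebraMap ℂ DiffRing c) (LaurentTensor.tmul 1 v)
        rw [AlgHom.commutes, Module.algebraMap_end_apply]
        exact (congrArg _ h2).trans (TensorProduct.tmul_smul _ _ _) }

/-- A `ℂ[[π]]`-module `N` of finite length is recovered from `ℂ((X)) ⊗ N` as the sections supported
at `p`, functorially. -/
def unitIso : (finLen.{u}).ι ≅ (finLen.{u}).ι ⋙ iota p ε hε ⋙ supportedAt p :=
  NatIso.ofComponents (fun N => (unitEquiv p ε hε N.obj N.property).toModuleIso)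
    (fun φ => by
      ext v
      rfl)

end Unit

/-! ### `ℂ((x))⟨∂⟩`-modules as difference modules -/

namespace KRing

lemma xd_mul_ofSeries (f : LaurentSeries ℂ) :
    xd * ofSeries f = ofSeries (euler f) + ofSeries f * xd := by
  have h : euler f = xpow 1 * LaurentSeries.derivative ℂ f := rfl
  rw [xd, mul_assoc, d_mul_ofSeries, mul_add, ← mul_assoc, ← mul_assoc, ← map_mul, ← map_mul,
    ← map_mul, h, mul_comm f, add_comm]

lemma d_eq : d = ofSeries (xpow (-1)) * xd := by
  rw [xd, ← mul_assoc, ← map_mul, xpow_mul, neg_add_cancel, xpow_zero, map_one, one_mul]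

lemma induction {P : KRing → Prop} (hc : ∀ c : ℂ, P (algebraMap ℂ KRing c))
    (hf : ∀ f, P (ofSeries f)) (hd : P d) (hadd : ∀ a b, P a → P b → P (a + b))
    (hmul : ∀ a b, P a → P b → P (a * b)) (a : KRing) : P a := by
  obtain ⟨x, rfl⟩ : ∃ x, mk x = a := RingQuot.mkAlgHom_surjective ℂ KRel a
  induction x using FreeAlgebra.induction with
  | grade0 r => rw [AlgHom.commutes]; exact hc r
  | grade1 g =>
    cases g with
    | f f => exact hf f
    | d => exact hd
  | mul x y hx hy => rw [map_mul]; exact hmul _ _ hx hy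
  | add x y hx hy => rw [map_add]; exact hadd _ _ hx hy

end KRing

/-- A homomorphism `ρ` from differential operators on `𝔾ₘ` to `ℂ((X))⟨∂⟩` such that the Mellin
transform lets `τ` act as `X ^ ε` and `z` as `ε X ∂`. -/
structure IsMellinInclusion (ε : ℤ) (ρ : GmRing →ₐ[ℂ] KRing) : Prop where
  map_z : ρ (mellinRingEquiv DiffRing.z) = (ε : ℂ) • KRing.xd
  map_t : ρ (mellinRingEquiv DiffRing.t) = KRing.ofSeries (xpow ε)
  map_tinv : ρ (mellinRingEquiv DiffRing.tinv) = KRing.ofSeries (xpow (-ε))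

/-- The Mellin transform of the restriction of scalars along `ρ`. -/
def mellinAlong (ρ : GmRing →ₐ[ℂ] KRing) : ModuleCat.{u} KRing ⥤ ModuleCat.{u} DiffRing :=
  ModuleCat.restrictScalars (ρ : GmRing →+* KRing) ⋙ mellin

section
variable (ρ : GmRing →ₐ[ℂ] KRing) (F : ModuleCat.{u} KRing)

instance : Module (LaurentSeries ℂ) ((mellinAlong ρ).obj F) := KRing.laurentModule F

instance : Module ℂ⟦X⟧ ((mellinAlong ρ).obj F) := KRing.powerModule F

variable {F}

/-- The vectors of the Mellin transform of `F` are those of `F`. -/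
def toMellin (v : F) : (mellinAlong ρ).obj F := v

lemma toMellin_surjective : Function.Surjective (toMellin ρ (F := F)) := fun v => ⟨v, rfl⟩

lemma smul_toMellin (a : DiffRing) (v : F) :
    a • toMellin ρ v = toMellin ρ (ρ (mellinRingEquiv a) • v) := rfl

lemma laurent_smul_toMellin (f : LaurentSeries ℂ) (v : F) :
    f • toMellin ρ v = toMellin ρ (KRing.ofSeries f • v) := rfl

lemma complex_smul_toMellin (c : ℂ) (v : F) :
    c • toMellin ρ v = toMellin ρ (algebraMap ℂ KRing c • v) := by
  rw [← algebraMap_smul DiffRing c (toMellin ρ v), smul_toMellin, AlgEquiv.commutes,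
    AlgHom.commutes]

variable (F)

instance : IsScalarTower ℂ (LaurentSeries ℂ) ((mellinAlong ρ).obj F) := ⟨fun c f v => by
  obtain ⟨v, rfl⟩ := toMellin_surjective ρ v
  rw [laurent_smul_toMellin, laurent_smul_toMellin, complex_smul_toMellin,
    ← HahnSeries.C_mul_eq_smul, map_mul, KRing.ofSeries_C, mul_smul]⟩

instance : IsScalarTower ℂ⟦X⟧ (LaurentSeries ℂ) ((mellinAlong ρ).obj F) := ⟨fun a f v => by
  obtain ⟨v, rfl⟩ := toMellin_surjective ρ v
  change _ = algebraMap ℂ⟦X⟧ (LaurentSeries ℂ) a • f • toMellin ρ v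
  rw [laurent_smul_toMellin, laurent_smul_toMellin, laurent_smul_toMellin, Algebra.smul_def,
    map_mul, mul_smul]⟩

variable {ρ F} {p : ℂ} {ε : ℤ}

lemma zSub_toMellin (hρ : IsMellinInclusion ε ρ) (v : F) :
    zSub p ((mellinAlong ρ).obj F) (toMellin ρ v) =
      toMellin ρ (((ε : ℂ) • KRing.xd - algebraMap ℂ KRing p) • v) := by
  have h : zSub p ((mellinAlong ρ).obj F) (toMellin ρ v) =
    (DiffRing.z - algebraMap ℂ DiffRing p) • toMellin ρ v := rfl
  rw [h, smul_toMellin, map_sub, map_sub, AlgEquiv.commutes, AlgHom.commutes, hρ.map_z]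

lemma isEulerOp_zSub (hρ : IsMellinInclusion ε ρ) :
    IsEulerOp (ε : ℂ) (zSub p ((mellinAlong ρ).obj F)) := by
  intro f v
  obtain ⟨v, rfl⟩ := toMellin_surjective ρ v
  have h : ((ε : ℂ) • KRing.xd - algebraMap ℂ KRing p) * KRing.ofSeries f =
      KRing.ofSeries ((ε : ℂ) • euler f) +
        KRing.ofSeries f * ((ε : ℂ) • KRing.xd - algebraMap ℂ KRing p) := by
    rw [sub_mul, smul_mul_assoc, KRing.xd_mul_ofSeries, ← HahnSeries.C_mul_eq_smul, map_mul,
      KRing.ofSeries_C, mul_sub, mul_smul_comm, smul_add,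
      ← Algebra.commutes p (KRing.ofSeries f), ← Algebra.smul_def, ← Algebra.smul_def,
      add_sub_assoc]
  rw [zSub_toMellin hρ, laurent_smul_toMellin, laurent_smul_toMellin, zSub_toMellin hρ,
    laurent_smul_toMellin, smul_smul, smul_smul, h, add_smul]
  rfl

/-- A regular holonomic module with leading term in `ε p + ℤ` has a lattice on which `z - p` is
nilpotent modulo `X`: a lattice with leading term `ε p + k` is multiplied by `X⁻ᵏ`. -/
lemma exists_isNilLattice (hε : ε * ε = 1) (hρ : IsMellinInclusion ε ρ)
    (hF : KRing.regHol (ε * p) F) :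
    ∃ n L, IsNilLattice (zSub p ((mellinAlong ρ).obj F)) n L := by
  obtain ⟨-, -, k, L, ⟨hfg, hspan⟩, hst, n, hn⟩ := hF
  have hA := isEulerOp_zSub (p := p) (F := F) hρ
  have hεε : (ε : ℂ) * ε = 1 := by exact_mod_cast hε
  let L : Submodule ℂ⟦X⟧ ((mellinAlong ρ).obj F) := L
  let s : (mellinAlong ρ).obj F →ₗ[ℂ⟦X⟧] (mellinAlong ρ).obj F :=
    { toFun := fun v => xpow (-k) • v
      map_add' := fun v w => smul_add _ _ _
      map_smul' := fun a v => by
        rw [RingHom.id_apply, ← algebraMap_smul (LaurentSeries ℂ) a,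
          ← algebraMap_smul (LaurentSeries ℂ) a, smul_smul, smul_smul, mul_comm] }
  have hs (v) : s v = xpow (-k) • v := rfl
  -- Past `X⁻ᵏ`, the operator `z - p` becomes `ε (x ∂ - (ε p + k))`.
  have hop (j : ℕ) (v : F) :
      ((zSub p ((mellinAlong ρ).obj F) +
          ((ε : ℂ) * ((-k : ℤ) : ℂ)) • (1 : Module.End ℂ ((mellinAlong ρ).obj F))) ^ j)
          (toMellin ρ v) =
        (ε : ℂ) ^ j • toMellin ρ ((KRing.xd - algebraMap ℂ KRing (ε * p + k)) ^ j • v) := by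
    induction j with
    | zero => simp
    | succ j ih =>
      rw [pow_succ', Module.End.mul_apply, ih, map_smul, pow_succ, mul_smul _ _ (toMellin ρ _)]
      refine congrArg (fun w : (mellinAlong ρ).obj F => (ε : ℂ) ^ j • w) ?_
      rw [LinearMap.add_apply, zSub_toMellin hρ, LinearMap.smul_apply, Module.End.one_apply,
        complex_smul_toMellin, complex_smul_toMellin, pow_succ', mul_smul]
      generalize (KRing.xd - algebraMap ℂ KRing (ε * p + k)) ^ j • v = w
      have h : ((ε : ℂ) • KRing.xd - algebraMap ℂ KRing p) + algebraMap ℂ KRing (ε * (-k : ℤ)) =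
          algebraMap ℂ KRing ε * (KRing.xd - algebraMap ℂ KRing (ε * p + k)) := by
        have h' : (ε : ℂ) * (ε * p + k) = p + ε * k := by
          rw [mul_add, ← mul_assoc, hεε, one_mul]
        rw [mul_sub, ← map_mul, h', ← Algebra.smul_def, map_add, Int.cast_neg, mul_neg, map_neg]
        abel
      rw [smul_smul _ _ w, ← h, add_smul]
      rfl
  refine ⟨n, L.map s, hfg.map s, ?_, ?_, ?_⟩
  · have h (v) (hv : v ∈ L) : v ∈ Submodule.span (LaurentSeries ℂ) (L.map s : Set _) := by
      have : v = xpow k • s v := by rw [hs, smul_smul, xpow_mul, add_neg_cancel, xpow_zero, one_smul]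
      rw [this]
      exact Submodule.smul_mem _ _ (Submodule.subset_span ⟨v, hv, rfl⟩)
    rw [eq_top_iff]
    have hspan : Submodule.span (LaurentSeries ℂ) (L : Set ((mellinAlong ρ).obj F)) = ⊤ := hspan
    exact hspan.ge.trans (Submodule.span_le.2 h)
  · rintro _ ⟨v, hv, rfl⟩
    obtain ⟨v, rfl⟩ := toMellin_surjective ρ v
    have h1 := hA.pow_xpow_smul (-k) 0 1 (toMellin ρ v)
    have h2 := hop 1 v
    rw [zero_smul, add_zero, zero_add, pow_one, pow_one] at h1
    rw [pow_one, pow_one, pow_one] at h2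
    refine ⟨(ε : ℂ) • toMellin ρ
      ((KRing.xd - algebraMap ℂ KRing (ε * p + k)) • v),
      complex_smul_mem L _ ?_, ?_⟩
    · rw [sub_smul]
      refine L.sub_mem (hst v hv) ?_
      have := complex_smul_mem L ((ε : ℂ) * p + k) hv
      rw [complex_smul_toMellin] at this
      exact this
    · rw [hs, ← h2]
      exact h1.symm
  · rintro _ ⟨v, hv, rfl⟩
    obtain ⟨w, hw, h⟩ := hn v hv
    have h1 := hA.pow_xpow_smul (-k) 0 n v
    rw [zero_smul, add_zero, zero_add] at h1
    let w : (mellinAlong ρ).obj F := w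
    refine ⟨s ((ε : ℂ) ^ n • w), ⟨_, complex_smul_mem L _ hw, rfl⟩, ?_⟩
    refine h1.trans ?_
    rw [← s.map_smul, hs]
    congr 1
    refine (hop n v).trans ?_
    rw [h, ← C_smul_eq, ← C_smul_eq, smul_smul, mul_comm, mul_smul]
    rfl

end

/-! ### Regular holonomic modules are recovered from the sections supported at `p` -/

section Counit
variable {p : ℂ} {ε : ℤ} (hε : ε * ε = 1) {ρ : GmRing →ₐ[ℂ] KRing} (hρ : IsMellinInclusion ε ρ)

/-- The inclusion of the sections supported at `p`. -/
def supportedAtVal (p : ℂ) (M : ModuleCat.{u} DiffRing) : (supportedAt p).obj M →ₗ[ℂ] M where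
  toFun v := v.1
  map_add' _ _ := rfl
  map_smul' c v := by
    rw [← algebraMap_smul ℂ⟦X⟧ c v]
    exact LocNil.C_smul_val (zSub p M) c v

lemma supportedAtVal_X_smul (M : ModuleCat.{u} DiffRing) (v : (supportedAt p).obj M) :
    supportedAtVal p M ((PowerSeries.X : ℂ⟦X⟧) • v) = zSub p M (supportedAtVal p M v) :=
  LocNil.X_smul_val (zSub p M) v

variable (p ρ) in
/-- The multiplication map `f ⊗ v ↦ f v` from `ℂ((X)) ⊗ ι_p^! M` to the Mellin transform `M` of a
`ℂ((X))⟨∂⟩`-module. -/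
def mulMap (F : ModuleCat.{u} KRing) :
    LaurentTensor ((supportedAt p).obj ((mellinAlong ρ).obj F)) →ₗ[ℂ] (mellinAlong ρ).obj F :=
  extend (supportedAtVal p ((mellinAlong ρ).obj F))

lemma mulMap_tmul (F : ModuleCat.{u} KRing) (f : LaurentSeries ℂ)
    (v : (supportedAt p).obj ((mellinAlong ρ).obj F)) :
    mulMap p ρ F (LaurentTensor.tmul f v) = f • supportedAtVal p _ v := rfl

include hρ in
lemma mulMap_iotaRep (F : ModuleCat.{u} KRing) (a : DiffRing)
    (t : LaurentTensor ((supportedAt p).obj ((mellinAlong ρ).obj F))) :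
    mulMap p ρ F (iotaRep p _ ε hε a t) = a • mulMap p ρ F t := by
  have ht (m : ℤ) (a : DiffRing) (ha : ρ (mellinRingEquiv a) = KRing.ofSeries (xpow m))
      (t : LaurentTensor ((supportedAt p).obj ((mellinAlong ρ).obj F))) :
      mulMap p ρ F (shiftOp _ m t) = a • mulMap p ρ F t := by
    induction t using LaurentTensor.induction with
    | h f v =>
      obtain ⟨w, hw⟩ := toMellin_surjective ρ (supportedAtVal p _ v)
      rw [shiftOp_tmul, mulMap_tmul, mulMap_tmul, ← hw, laurent_smul_toMellin,
        laurent_smul_toMellin, smul_toMellin, ha, map_mul, mul_smul]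
    | hadd s t hs ht => rw [map_add, map_add, map_add, smul_add, hs, ht]
  induction a using DiffRing.induction generalizing t with
  | hc c => rw [AlgHom.commutes, Module.algebraMap_end_apply, map_smul, algebraMap_smul]
  | hz =>
    induction t using LaurentTensor.induction with
    | h f v =>
      have h1 := zSubTensor_tmul p ε f v
      rw [zSubTensor, LinearMap.sub_apply, sub_eq_iff_eq_add] at h1
      rw [iotaRep, DiffRing.lift_z, h1, map_add, map_add, map_smul, LinearMap.smul_apply, map_smul,
        Module.End.one_apply, mulMap_tmul, mulMap_tmul, mulMap_tmul, supportedAtVal_X_smul]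
      have h2 := isEulerOp_zSub (p := p) (F := F) hρ f (supportedAtVal p _ v)
      rw [smul_assoc] at h2
      rw [← h2]
      have h3 (w : (mellinAlong ρ).obj F) : DiffRing.z • w = zSub p _ w + p • w := by
        have : zSub p _ w = (DiffRing.z - algebraMap ℂ DiffRing p) • w := rfl
        rw [this, sub_smul, algebraMap_smul, sub_add_cancel]
      rw [h3]
    | hadd s t hs ht => rw [map_add, map_add, map_add, smul_add, hs, ht]
  | ht =>
    rw [iotaRep, DiffRing.lift_t]
    exact ht _ _ hρ.map_t t
  | htinv =>
    rw [iotaRep, DiffRing.lift_tinv]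
    exact ht _ _ hρ.map_tinv t
  | hadd a b ha hb => rw [map_add, LinearMap.add_apply, map_add, ha, hb, add_smul]
  | hmul a b ha hb => rw [map_mul, Module.End.mul_apply, ha, hb, mul_smul]

include hε hρ in
lemma mulMap_bijective (F : ModuleCat.{u} KRing) (hF : KRing.regHol (ε * p) F) :
    Function.Bijective (mulMap p ρ F) := by
  obtain ⟨n, L, hL⟩ := exists_isNilLattice hε hρ hF
  refine hL.extend_bijective (by rintro h; rw [Int.cast_eq_zero] at h; simp [h] at hε)
    (isEulerOp_zSub hρ) _ (fun v w h => Subtype.ext h) (fun v => v.2) (fun w hw => ⟨⟨w, hw⟩, rfl⟩)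

include hε hρ in
lemma finLen_supportedAt (F : ModuleCat.{u} KRing) (hF : KRing.regHol (ε * p) F) :
    finLen ((supportedAt p).obj ((mellinAlong ρ).obj F)) := by
  obtain ⟨n, L, hL⟩ := exists_isNilLattice hε hρ hF
  have : Module.Finite (LaurentSeries ℂ) ((mellinAlong ρ).obj F) := hF.1
  have := hL.finite_locNil (by rintro h; rw [Int.cast_eq_zero] at h; simp [h] at hε)
    (isEulerOp_zSub hρ)
  exact isFiniteLength_locNil _

/-- The isomorphism `ℂ((X)) ⊗ ι_p^! M ≅ M` of difference modules. -/
def counitEquiv (F : ModuleCat.{u} KRing) (hF : KRing.regHol (ε * p) F) :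
    (iota p ε hε).obj ((supportedAt p).obj ((mellinAlong ρ).obj F)) ≃ₗ[DiffRing]
      (mellinAlong ρ).obj F :=
  let μ : (iota p ε hε).obj ((supportedAt p).obj ((mellinAlong ρ).obj F)) →ₗ[DiffRing]
      (mellinAlong ρ).obj F :=
    { toFun := mulMap p ρ F
      map_add' := map_add (mulMap p ρ F)
      map_smul' := mulMap_iotaRep hε hρ F }
  LinearEquiv.ofBijective μ (mulMap_bijective hε hρ F hF)

lemma mulMap_naturality {F F' : ModuleCat.{u} KRing} (φ : F ⟶ F')
    (t : LaurentTensor ((supportedAt p).obj ((mellinAlong ρ).obj F))) :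
    mulMap p ρ F' (LaurentTensor.map ((supportedAt p).map ((mellinAlong ρ).map φ)) t) =
      ((mellinAlong ρ).map φ).hom (mulMap p ρ F t) := by
  induction t using LaurentTensor.induction with
  | h f v =>
    rw [LaurentTensor.map_tmul, mulMap_tmul, mulMap_tmul]
    exact (φ.hom.map_smul (KRing.ofSeries f) _).symm
  | hadd s t hs ht => rw [map_add, map_add, map_add, map_add, hs, ht]

/-- The isomorphism `ℂ((X)) ⊗ ι_p^! M ≅ M` is functorial. -/
def counitIso : (KRing.regHol.{u} (ε * p)).ι ⋙ mellinAlong ρ ⋙ supportedAt p ⋙ iota p ε hε ≅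
    (KRing.regHol.{u} (ε * p)).ι ⋙ mellinAlong ρ :=
  NatIso.ofComponents (fun F => (counitEquiv hε hρ F.obj F.property).toModuleIso)
    (fun {F F'} φ => by
      ext t
      exact mulMap_naturality φ.hom t)

lemma counitIso_adicHomeo (F : (KRing.regHol.{u} (ε * p)).FullSubcategory) :
    IsAdicHomeo (F := F.obj) (N := (supportedAt p).obj ((mellinAlong ρ).obj F.obj))
      (fun v => ((counitIso hε hρ).symm.hom.app F).hom v) := by
  let μ : LaurentTensor ((supportedAt p).obj ((mellinAlong ρ).obj F.obj)) →ₗ[ℂ⟦X⟧]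
      (mellinAlong ρ).obj F.obj :=
    { toFun := mulMap p ρ F.obj
      map_add' := map_add (mulMap p ρ F.obj)
      map_smul' := fun a t => extend_smul _ (algebraMap ℂ⟦X⟧ (LaurentSeries ℂ) a) t }
  exact isHomeomorph_adic (LinearEquiv.ofBijective μ (mulMap_bijective hε hρ F.obj F.property)).symm

end Counit

/-! ### The `ℂ((x))⟨∂⟩`-module `ℂ((x)) ⊗ N` -/

lemma xpow_mul_powerSeriesPart (f : LaurentSeries ℂ) :
    f = xpow f.order * algebraMap ℂ⟦X⟧ (LaurentSeries ℂ) f.powerSeriesPart := by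
  rw [LaurentSeries.coe_algebraMap, xpow, LaurentSeries.single_order_mul_powerSeriesPart]

lemma euler_mul (f g : LaurentSeries ℂ) : euler (f * g) = euler f * g + f * euler g := by
  rw [xpow_mul_powerSeriesPart f, xpow_mul_powerSeriesPart g]
  generalize f.order = a, g.order = b, f.powerSeriesPart = F, g.powerSeriesPart = G
  rw [mul_mul_mul_comm, xpow_mul, ← map_mul, euler_xpow_mul, euler_xpow_mul, euler_xpow_mul,
    euler_powerSeries, euler_powerSeries, euler_powerSeries, Derivation.leibniz, ← xpow_mul]
  simp only [← HahnSeries.C_mul_eq_smul, map_mul, map_add, smul_eq_mul, Int.cast_add]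
  ring

lemma derivative_eq_xpow_mul_euler (f : LaurentSeries ℂ) :
    LaurentSeries.derivative ℂ f = xpow (-1) * euler f := by
  have h : euler f = xpow 1 * LaurentSeries.derivative ℂ f := rfl
  rw [h, ← mul_assoc, xpow_mul, neg_add_cancel, xpow_zero, one_mul]

section Construction
variable (p : ℂ) (ε : ℤ) (N : ModuleCat.{u} ℂ⟦X⟧)

/-- Multiplication by a Laurent series on `ℂ((X)) ⊗ N`. -/
def mulOp (f : LaurentSeries ℂ) : Module.End ℂ (LaurentTensor N) :=
  (LinearMap.mulLeft ℂ f).rTensor N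

lemma mulOp_tmul (f g : LaurentSeries ℂ) (v : N) :
    mulOp N f (LaurentTensor.tmul g v) = LaurentTensor.tmul (f * g) v := rfl

lemma mulOp_apply (f : LaurentSeries ℂ) (t : LaurentTensor N) : mulOp N f t = f • t := by
  induction t using LaurentTensor.induction with
  | h g v => rfl
  | hadd s t hs ht => rw [map_add, smul_add, hs, ht]

lemma eulerOp_mulOp (f : LaurentSeries ℂ) :
    eulerOp p N ε * mulOp N f = mulOp N f * eulerOp p N ε + (ε : ℂ) • mulOp N (euler f) := by
  refine LaurentTensor.hom_ext fun g v => ?_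
  rw [Module.End.mul_apply, LinearMap.add_apply, Module.End.mul_apply, LinearMap.smul_apply,
    mulOp_tmul, mulOp_tmul, eulerOp_tmul, eulerOp_tmul, map_add, map_smul, mulOp_tmul, mulOp_tmul,
    euler_mul, LaurentTensor.add_tmul, smul_add]
  abel

/-- The action of `ℂ((X))⟨∂⟩` on `ℂ((X)) ⊗ N` with `ε X ∂` acting as `z`. -/
def kRep (hε : ε * ε = 1) : KRing →ₐ[ℂ] Module.End ℂ (LaurentTensor N) :=
  RingQuot.liftAlgHom ℂ ⟨FreeAlgebra.lift ℂ (fun g => match g with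
    | .f f => mulOp N f
    | .d => mulOp N (xpow (-1)) * (ε : ℂ) • eulerOp p N ε), by
      have hεε : (ε : ℂ) * ε = 1 := by exact_mod_cast hε
      intro x y hxy
      cases hxy with
      | scalar c =>
        rw [FreeAlgebra.lift_ι_apply, AlgHom.commutes]
        refine LaurentTensor.hom_ext fun g v => ?_
        rw [mulOp_tmul, HahnSeries.C_mul_eq_smul]
        rfl
      | add f g =>
        rw [map_add]
        simp only [FreeAlgebra.lift_ι_apply]
        refine LaurentTensor.hom_ext fun h v => ?_
        rw [mulOp_tmul, add_mul, LaurentTensor.add_tmul]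
        rfl
      | mul f g =>
        rw [map_mul]
        simp only [FreeAlgebra.lift_ι_apply]
        refine LaurentTensor.hom_ext fun h v => ?_
        rw [mulOp_tmul, mul_assoc]
        rfl
      | leibniz f =>
        rw [map_mul, map_add, map_mul]
        simp only [FreeAlgebra.lift_ι_apply]
        have hm (f g : LaurentSeries ℂ) : mulOp N f * mulOp N g = mulOp N (f * g) :=
          LaurentTensor.hom_ext fun h v => by
            rw [Module.End.mul_apply, mulOp_tmul, mulOp_tmul, mulOp_tmul, mul_assoc]
        rw [mul_assoc, smul_mul_assoc, eulerOp_mulOp, smul_add, smul_smul, hεε, one_smul, mul_add,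
          ← mul_smul_comm, ← mul_assoc, ← mul_assoc, hm, hm, hm, ← derivative_eq_xpow_mul_euler,
          mul_comm f]⟩

lemma kRep_ofSeries (hε : ε * ε = 1) (f : LaurentSeries ℂ) :
    kRep p ε N hε (KRing.ofSeries f) = mulOp N f := by
  refine (RingQuot.liftAlgHom_mkAlgHom_apply ..).trans ?_
  simp

lemma kRep_xd (hε : ε * ε = 1) : kRep p ε N hε KRing.xd = (ε : ℂ) • eulerOp p N ε := by
  have h : kRep p ε N hε KRing.d = mulOp N (xpow (-1)) * (ε : ℂ) • eulerOp p N ε := by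
    refine (RingQuot.liftAlgHom_mkAlgHom_apply ..).trans ?_
    simp
  rw [KRing.xd, map_mul, kRep_ofSeries, h, ← mul_assoc]
  refine LinearMap.ext fun t => ?_
  rw [Module.End.mul_apply, Module.End.mul_apply, mulOp_apply, mulOp_apply, smul_smul, xpow_mul,
    add_neg_cancel, xpow_zero, one_smul]

/-- The `ℂ((X))⟨∂⟩`-module `ℂ((X)) ⊗ N`. -/
def kObj (hε : ε * ε = 1) : ModuleCat.{u} KRing :=
  letI : Module KRing (LaurentTensor N) :=
    Module.compHom (LaurentTensor N) (kRep p ε N hε).toRingHom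
  ModuleCat.of KRing (LaurentTensor N)

variable {p ε N} (hε : ε * ε = 1)

instance : IsScalarTower ℂ (LaurentSeries ℂ) (LaurentTensor N) :=
  ⟨fun c f t => by
    induction t using LaurentTensor.induction with
    | h g v =>
      rw [LaurentTensor.smul_tmul_left, LaurentTensor.smul_tmul_left, ← LaurentTensor.smul_tmul,
        smul_mul_assoc]
    | hadd s t hs ht => rw [smul_add, smul_add, smul_add, hs, ht]⟩

instance : IsScalarTower ℂ⟦X⟧ (LaurentSeries ℂ) (LaurentTensor N) :=
  ⟨fun a f t => by
    rw [Algebra.smul_def, mul_smul]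
    rfl⟩

lemma isEulerOp_zSubTensor : IsEulerOp (ε : ℂ) (zSubTensor p ε N) := by
  intro f t
  have h := LinearMap.congr_fun (eulerOp_mulOp p ε N f) t
  rw [LinearMap.add_apply, Module.End.mul_apply, Module.End.mul_apply, LinearMap.smul_apply,
    mulOp_apply, mulOp_apply, mulOp_apply] at h
  rw [zSubTensor, LinearMap.sub_apply, LinearMap.sub_apply, h, LinearMap.smul_apply,
    LinearMap.smul_apply, Module.End.one_apply, Module.End.one_apply, smul_sub,
    complex_smul_smul_comm, smul_assoc]
  abel

variable (N) in
/-- The lattice `ℂ[[X]] ⊗ N` in `ℂ((X)) ⊗ N`. -/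
def tensorLattice : Submodule ℂ⟦X⟧ (LaurentTensor N) :=
  Submodule.span ℂ⟦X⟧ (Set.range (LaurentTensor.tmul (1 : LaurentSeries ℂ) (N := N)))

lemma one_tmul_mem (v : N) : LaurentTensor.tmul 1 v ∈ tensorLattice N :=
  Submodule.subset_span ⟨v, rfl⟩

lemma tensorLattice_fg [Module.Finite ℂ N] : (tensorLattice N).FG := by
  let b := Module.finBasis ℂ N
  let φ : N →ₗ[ℂ] LaurentTensor N := TensorProduct.mk ℂ (LaurentSeries ℂ) N 1
  have h : tensorLattice N =
      Submodule.span ℂ⟦X⟧ (Set.range fun i => LaurentTensor.tmul 1 (b i)) := by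
    refine le_antisymm (Submodule.span_le.2 ?_) (Submodule.span_mono ?_)
    · rintro _ ⟨v, rfl⟩
      change φ v ∈ _
      have hv : v ∈ Submodule.span ℂ (Set.range b) := b.span_eq ▸ Submodule.mem_top
      induction hv using Submodule.span_induction with
      | mem v hv =>
        obtain ⟨i, rfl⟩ := hv
        exact Submodule.subset_span ⟨i, rfl⟩
      | zero => exact (map_zero φ).symm ▸ Submodule.zero_mem _
      | add v w _ _ h h' => exact (map_add φ v w).symm ▸ Submodule.add_mem _ h h'
      | smul c v _ h => exact (map_smul φ c v).symm ▸ complex_smul_mem _ c h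
    · rintro _ ⟨i, rfl⟩
      exact ⟨b i, rfl⟩
  rw [h]
  exact Submodule.fg_span (Set.finite_range _)

lemma span_tensorLattice :
    Submodule.span (LaurentSeries ℂ) (tensorLattice N : Set (LaurentTensor N)) = ⊤ := by
  rw [eq_top_iff]
  rintro t -
  induction t using LaurentTensor.induction with
  | h f v =>
    rw [← mul_one f, ← LaurentTensor.smul_tmul_left]
    exact Submodule.smul_mem _ f (Submodule.subset_span (one_tmul_mem v))
  | hadd s t hs ht => exact Submodule.add_mem _ hs ht

lemma zSubTensor_mem {t : LaurentTensor N} (ht : t ∈ tensorLattice N) :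
    zSubTensor p ε N t ∈ tensorLattice N := by
  induction ht using Submodule.span_induction with
  | mem t ht =>
    obtain ⟨v, rfl⟩ := ht
    have h := zSubTensor_pow_one_tmul p ε 1 v
    rw [pow_one, pow_one] at h
    rw [h]
    exact one_tmul_mem _
  | zero => rw [map_zero]; exact Submodule.zero_mem _
  | add s t _ _ hs ht => rw [map_add]; exact Submodule.add_mem _ hs ht
  | smul a t ht h =>
    have h1 := isEulerOp_zSubTensor (p := p) (ε := ε) (algebraMap ℂ⟦X⟧ (LaurentSeries ℂ) a) t
    rw [euler_powerSeries, smul_assoc, algebraMap_smul, algebraMap_smul, algebraMap_smul] at h1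
    rw [h1]
    exact Submodule.add_mem _ (complex_smul_mem _ _ (Submodule.smul_mem _ _ ht))
      (Submodule.smul_mem _ _ h)

/-- Since `πⁿ = 0` on `N`, the operator `(z - p)ⁿ` kills `1 ⊗ N`, and it preserves `X ℂ[[X]] ⊗ N`. -/
lemma isNilLattice_tensor (hN : IsFiniteLength ℂ⟦X⟧ N) :
    ∃ n, IsNilLattice (zSubTensor p ε N) n (tensorLattice N) := by
  have := finite_complex_of_isFiniteLength hN
  obtain ⟨n, hn⟩ := exists_X_pow_smul_eq_zero hN
  refine ⟨n, tensorLattice_fg, span_tensorLattice, fun t => zSubTensor_mem, fun t ht => ?_⟩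
  induction ht using Submodule.closure_induction with
  | zero => exact ⟨0, Submodule.zero_mem _, by rw [map_zero, smul_zero]⟩
  | add s t _ _ hs ht =>
    obtain ⟨w, hw, h⟩ := hs
    obtain ⟨w', hw', h'⟩ := ht
    exact ⟨w + w', Submodule.add_mem _ hw hw', by rw [map_add, smul_add, h, h']⟩
  | smul_mem a t ht =>
    obtain ⟨v, rfl⟩ := ht
    obtain ⟨a', ha⟩ : ∃ a', a = PowerSeries.X * a' + PowerSeries.C (PowerSeries.constantCoeff a) :=
      ⟨_, PowerSeries.eq_X_mul_shift_add_const _⟩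
    have h0 : (zSubTensor p ε N ^ n) (LaurentTensor.tmul 1 v) = 0 := by
      rw [zSubTensor_pow_one_tmul, hn]
      exact TensorProduct.tmul_zero _ _
    have h1 := (isEulerOp_zSubTensor (p := p) (ε := ε)).pow_xpow_smul (1 : ℕ) 0 n
      (a' • LaurentTensor.tmul 1 v)
    rw [zero_smul, add_zero, ← X_pow_smul_eq, ← X_pow_smul_eq, pow_one] at h1
    refine ⟨((zSubTensor p ε N +
      (0 + (ε : ℂ) * ((1 : ℕ) : ℤ)) • (1 : Module.End ℂ (LaurentTensor N))) ^ n)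
      (a' • LaurentTensor.tmul 1 v), ?_, ?_⟩
    · generalize (0 + (ε : ℂ) * ((1 : ℕ) : ℤ)) = c
      have hm : a' • LaurentTensor.tmul 1 v ∈ tensorLattice N :=
        Submodule.smul_mem _ _ (one_tmul_mem v)
      generalize a' • LaurentTensor.tmul 1 v = t at hm
      clear h1 h0 hn
      induction n with
      | zero => exact hm
      | succ n ih =>
        rw [pow_succ', Module.End.mul_apply]
        exact Submodule.add_mem _ (zSubTensor_mem ih) (complex_smul_mem _ _ ih)
    · rw [ha, add_smul, mul_smul, map_add, h1, C_smul_eq,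
        (zSubTensor p ε N ^ n).map_smul, h0, smul_zero, add_zero]

lemma regHol_kObj (hN : IsFiniteLength ℂ⟦X⟧ N) : KRing.regHol (ε * p) (kObj p ε N hε) := by
  have hεε : (ε : ℂ) * ε = 1 := by exact_mod_cast hε
  have hK : KRing.laurentModule (kObj p ε N hε) =
      (inferInstance : Module (LaurentSeries ℂ) (LaurentTensor N)) :=
    Module.ext' _ _ fun f (t : LaurentTensor N) => by
      change kRep p ε N hε (KRing.ofSeries f) t = f • t
      rw [kRep_ofSeries, mulOp_apply]
  have hP : KRing.powerModule (kObj p ε N hε) =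
      (inferInstance : Module ℂ⟦X⟧ (LaurentTensor N)) :=
    Module.ext' _ _ fun a (t : LaurentTensor N) => by
      change kRep p ε N hε (KRing.ofSeries (algebraMap ℂ⟦X⟧ (LaurentSeries ℂ) a)) t =
        algebraMap ℂ⟦X⟧ (LaurentSeries ℂ) a • t
      rw [kRep_ofSeries, mulOp_apply]
  obtain ⟨n, hL⟩ := isNilLattice_tensor (p := p) (ε := ε) hN
  have hfin : Module.Finite (LaurentSeries ℂ) (LaurentTensor N) := by
    obtain ⟨S, hS⟩ := hL.fg
    refine ⟨S, ?_⟩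
    rw [← hL.span, ← hS, Submodule.span_span_of_tower]
  have hxd (v : LaurentTensor N) (hv : v ∈ tensorLattice N) :
      kRep p ε N hε KRing.xd v ∈ tensorLattice N := by
    have h : eulerOp p N ε = zSubTensor p ε N + p • (1 : Module.End ℂ (LaurentTensor N)) :=
      (sub_add_cancel _ _).symm
    rw [kRep_xd, h]
    exact complex_smul_mem _ _ (Submodule.add_mem _ (hL.stable v hv) (complex_smul_mem _ _ hv))
  have hnil (v : LaurentTensor N) (hv : v ∈ tensorLattice N) : ∃ w ∈ tensorLattice N,
      kRep p ε N hε ((KRing.xd - algebraMap ℂ KRing (ε * p + (0 : ℤ))) ^ n) v =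
        (PowerSeries.X : ℂ⟦X⟧) • w := by
    obtain ⟨w, hw, h⟩ := hL.nil v hv
    refine ⟨(ε : ℂ) ^ n • w, complex_smul_mem _ _ hw, ?_⟩
    have h1 : kRep p ε N hε (KRing.xd - algebraMap ℂ KRing (ε * p + (0 : ℤ))) =
        (ε : ℂ) • zSubTensor p ε N := by
      rw [map_sub, kRep_xd, AlgHom.commutes, Algebra.algebraMap_eq_smul_one, Int.cast_zero,
        add_zero, mul_smul, ← smul_sub]
      rfl
    rw [map_pow, h1, smul_pow, LinearMap.smul_apply, h, ← C_smul_eq, ← C_smul_eq, smul_smul,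
      smul_smul, mul_comm]
  unfold KRing.regHol KRing.IsHolonomic KRing.IsRegular KRing.HasLeadingTerm KRing.IsLattice
  rw [hK, hP]
  exact ⟨hfin, ⟨_, ⟨hL.fg, hL.span⟩, hxd⟩, 0, _, ⟨hL.fg, hL.span⟩, hxd, n, hnil⟩

variable {ρ : GmRing →ₐ[ℂ] KRing} (hρ : IsMellinInclusion ε ρ)

include hρ in
lemma kRep_comp_eq_iotaRep (a : DiffRing) :
    kRep p ε N hε (ρ (mellinRingEquiv a)) = iotaRep p N ε hε a := by
  have hεε : (ε : ℂ) * ε = 1 := by exact_mod_cast hε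
  refine DFunLike.congr_fun (DiffRing.algHom_ext
    (f := ((kRep p ε N hε).comp ρ).comp mellinRingEquiv.toAlgHom) ?_ ?_ ?_) a
  · change kRep p ε N hε (ρ (mellinRingEquiv DiffRing.z)) = _
    rw [hρ.map_z, map_smul, kRep_xd, smul_smul, hεε, one_smul, iotaRep, DiffRing.lift_z]
  · change kRep p ε N hε (ρ (mellinRingEquiv DiffRing.t)) = _
    rw [hρ.map_t, kRep_ofSeries, iotaRep, DiffRing.lift_t]
    rfl
  · change kRep p ε N hε (ρ (mellinRingEquiv DiffRing.tinv)) = _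
    rw [hρ.map_tinv, kRep_ofSeries, iotaRep, DiffRing.lift_tinv]
    rfl

/-- The Mellin transform of the `ℂ((X))⟨∂⟩`-module `ℂ((X)) ⊗ N` is the difference module
`ℂ((X)) ⊗ N`. -/
def mellinKObjIso : (mellinAlong ρ).obj (kObj p ε N hε) ≅ (iota p ε hε).obj N :=
  let e : (mellinAlong ρ).obj (kObj p ε N hε) ≃ₗ[DiffRing] (iota p ε hε).obj N :=
    { AddEquiv.refl (LaurentTensor N) with
      map_smul' := fun a t => LinearMap.congr_fun (kRep_comp_eq_iotaRep (N := N) hε hρ a) t }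
  e.toModuleIso

end Construction

/-! ### The equivalence -/

section Equivalence
variable {p : ℂ} {ε : ℤ} (hε : ε * ε = 1) {ρ : GmRing →ₐ[ℂ] KRing} (hρ : IsMellinInclusion ε ρ)

variable (p ρ) in
/-- The functor `F ↦ ι_p^! M`, where `M` is the Mellin transform of `F`. -/
def mellinFunctor {P : ObjectProperty (ModuleCat.{u} KRing)}
    (h : ∀ F : P.FullSubcategory, finLen ((supportedAt p).obj ((mellinAlong ρ).obj F.obj))) :
    P.FullSubcategory ⥤ (finLen.{u}).FullSubcategory :=
  finLen.lift (P.ι ⋙ mellinAlong ρ ⋙ supportedAt p) h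

variable (h : ∀ F : (KRing.regHol.{u} (ε * p)).FullSubcategory,
  finLen ((supportedAt p).obj ((mellinAlong ρ).obj F.obj)))

include hε hρ in
lemma mellinFunctor_faithful : (mellinFunctor p ρ h).Faithful where
  map_injective {F F'} φ ψ hφ := by
    have hS : (supportedAt p).map ((mellinAlong ρ).map φ.hom) =
        (supportedAt p).map ((mellinAlong ρ).map ψ.hom) :=
      congrArg (fun f => f.hom) hφ
    ext v
    obtain ⟨t, ht⟩ := (mulMap_bijective hε hρ F.obj F.property).2 v
    have h1 := mulMap_naturality (p := p) (ρ := ρ) φ.hom t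
    have h2 := mulMap_naturality (p := p) (ρ := ρ) ψ.hom t
    rw [hS, h2, ht] at h1
    exact h1.symm

/-- An additive map between `ℂ((x))⟨∂⟩`-modules which commutes with Laurent series and with `x ∂` is
linear. -/
def linearOfCommutes {F F' : ModuleCat.{u} KRing} (φ : F →+ F')
    (hf : ∀ f v, φ (KRing.ofSeries f • v) = KRing.ofSeries f • φ v)
    (hd : ∀ v, φ (KRing.xd • v) = KRing.xd • φ v) : F →ₗ[KRing] F' :=
  { φ with
    map_smul' := fun a => by
      refine KRing.induction (P := fun a => ∀ v, φ (a • v) = a • φ v) (fun c v => ?_) hf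
        (fun v => ?_) (fun a b ha hb v => ?_) (fun a b ha hb v => ?_) a
      · rw [← KRing.ofSeries_C, hf]
      · rw [KRing.d_eq, mul_smul, mul_smul, hf, hd]
      · rw [add_smul, add_smul, map_add, ha, hb]
      · rw [mul_smul, mul_smul, ha, hb] }

include hε hρ in
lemma mellinFunctor_full : (mellinFunctor p ρ h).Full where
  map_surjective {F F'} g := by
    have hεε : (ε : ℂ) * ε = 1 := by exact_mod_cast hε
    let g' : (supportedAt p).obj ((mellinAlong ρ).obj F.obj) ⟶
      (supportedAt p).obj ((mellinAlong ρ).obj F'.obj) := g.hom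
    let e := counitEquiv hε hρ F.obj F.property
    let e' := counitEquiv hε hρ F'.obj F'.property
    -- The map induced by `1 ⊗ g` is linear over difference operators and over Laurent series.
    let ψ : (mellinAlong ρ).obj F.obj →ₗ[DiffRing] (mellinAlong ρ).obj F'.obj :=
      e'.toLinearMap ∘ₗ ((iota p ε hε).map g').hom ∘ₗ e.symm.toLinearMap
    have hψ (t : LaurentTensor ((supportedAt p).obj ((mellinAlong ρ).obj F.obj))) :
        ψ (mulMap p ρ F.obj t) = mulMap p ρ F'.obj (LaurentTensor.map g' t) :=
      congrArg (fun s => e' (((iota p ε hε).map g').hom s)) (e.symm_apply_apply t)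
    have hlaurent (f : LaurentSeries ℂ) (v : (mellinAlong ρ).obj F.obj) : ψ (f • v) = f • ψ v := by
      obtain ⟨t, rfl⟩ := (mulMap_bijective hε hρ F.obj F.property).2 v
      have h1 : LaurentTensor.map g' (f • t) = f • LaurentTensor.map g' t := by
        induction t using LaurentTensor.induction with
        | h k v => rfl
        | hadd s t hs ht => rw [smul_add, map_add, map_add, smul_add, hs, ht]
      rw [hψ, mulMap, ← extend_smul, ← mulMap, hψ, h1]
      exact extend_smul _ _ _
    have hxd (G : ModuleCat.{u} KRing) (v : G) : toMellin ρ (KRing.xd • v) =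
        (ε : ℂ) • DiffRing.z • toMellin ρ v := by
      rw [smul_toMellin, hρ.map_z, complex_smul_toMellin, smul_smul, ← Algebra.smul_def, smul_smul,
        hεε, one_smul]
    let φ : F.obj →ₗ[KRing] F'.obj := linearOfCommutes ψ.toAddMonoidHom hlaurent fun v => by
      have h1 : ψ (toMellin ρ (KRing.xd • v)) =
          toMellin ρ (KRing.xd • (show F'.obj from ψ (toMellin ρ v))) := by
        rw [hxd, hxd, ← algebraMap_smul DiffRing, ← algebraMap_smul DiffRing, map_smul, map_smul]
        rfl
      exact h1
    refine ⟨ObjectProperty.homMk (ModuleCat.ofHom φ), ?_⟩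
    have h1 (v : (supportedAt p).obj ((mellinAlong ρ).obj F.obj)) :
        ψ (supportedAtVal p _ v) = supportedAtVal p _ (g'.hom v) := by
      have h1 := hψ (LaurentTensor.tmul 1 v)
      rwa [LaurentTensor.map_tmul, mulMap_tmul, mulMap_tmul, one_smul, one_smul] at h1
    ext v
    exact Subtype.ext (h1 v)

include hε hρ in
lemma mellinFunctor_essSurj : (mellinFunctor p ρ h).EssSurj where
  mem_essImage N :=
    ⟨⟨kObj p ε N.obj hε, regHol_kObj hε N.property⟩, ⟨ObjectProperty.isoMk _
      ((supportedAt p).mapIso (mellinKObjIso hε hρ) ≪≫ ((unitIso p ε hε).app N).symm)⟩⟩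

include hε hρ in
lemma mellinFunctor_isEquivalence : (mellinFunctor p ρ h).IsEquivalence where
  faithful := mellinFunctor_faithful hε hρ h
  full := mellinFunctor_full hε hρ h
  essSurj := mellinFunctor_essSurj hε hρ h

include hε in
/-- A functor `G` with `ℂ((X)) ⊗ G(F)` isomorphic to the Mellin transform of `F` is isomorphic to
the functor of sections supported at `p`, as these recover `G(F)`. -/
lemma nonempty_iso_mellinFunctor {P : ObjectProperty (ModuleCat.{u} KRing)}
    (h : ∀ F : P.FullSubcategory, finLen ((supportedAt p).obj ((mellinAlong ρ).obj F.obj)))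
    (G : P.FullSubcategory ⥤ (finLen.{u}).FullSubcategory)
    (α : P.ι ⋙ mellinAlong ρ ≅ G ⋙ finLen.ι ⋙ iota p ε hε) :
    Nonempty (G ≅ mellinFunctor p ρ h) :=
  ⟨(finLen.fullyFaithfulι.whiskeringRight _).preimageIso
    (Functor.isoWhiskerLeft G (unitIso p ε hε) ≪≫
      Functor.isoWhiskerRight α.symm (supportedAt p))⟩

include hρ in
/-- The statement about local Mellin transforms, uniformly for `0` (where `ε = 1`) and `∞` (where
`ε = -1`). -/
theorem mellinFunctor_equivalence_and_unique {q : ℂ} (hq : q = ε * p) :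
    ∃ h : ∀ F : (KRing.regHol.{u} q).FullSubcategory,
        finLen ((supportedAt p).obj ((mellinAlong ρ).obj F.obj)),
      (mellinFunctor p ρ h).IsEquivalence ∧
      (∃ α : (KRing.regHol.{u} q).ι ⋙ mellinAlong ρ ≅
          mellinFunctor p ρ h ⋙ finLen.ι ⋙ iota p ε hε,
        ∀ F, IsAdicHomeo (F := F.obj) (N := ((mellinFunctor p ρ h).obj F).obj)
          (fun v => (α.hom.app F).hom v)) ∧
      ∀ G : (KRing.regHol.{u} q).FullSubcategory ⥤ (finLen.{u}).FullSubcategory,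
        (∃ α : (KRing.regHol.{u} q).ι ⋙ mellinAlong ρ ≅ G ⋙ finLen.ι ⋙ iota p ε hε,
          ∀ F, IsAdicHomeo (F := F.obj) (N := (G.obj F).obj) (fun v => (α.hom.app F).hom v)) →
        Nonempty (G ≅ mellinFunctor p ρ h) := by
  subst hq
  exact ⟨fun F => finLen_supportedAt hε hρ F.obj F.property,
    mellinFunctor_isEquivalence hε hρ _, ⟨(counitIso hε hρ).symm, counitIso_adicHomeo hε hρ⟩,
    fun G hG => nonempty_iso_mellinFunctor hε _ G hG.choose⟩

end Equivalence

/-! ### The inclusions at `0` and at `∞` -/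

lemma isMellinInclusion_inclZero : IsMellinInclusion 1 inclZero where
  map_z := by
    simp [mellinRingEquiv, inclZero, DiffRing.lift_z, GmRing.lift_x, GmRing.lift_d, KRing.xd]
  map_t := by
    simp [mellinRingEquiv, inclZero, DiffRing.lift_t, GmRing.lift_x]
  map_tinv := by
    simp [mellinRingEquiv, inclZero, DiffRing.lift_tinv, GmRing.lift_xinv]

lemma isMellinInclusion_inclInfty : IsMellinInclusion (-1) inclInfty where
  map_z := by
    have h : mellinRingEquiv DiffRing.z = GmRing.x * GmRing.d := DiffRing.lift_z ..
    rw [h, map_mul, inclInfty, GmRing.lift_x, GmRing.lift_d, mul_neg, ← mul_assoc, ← map_mul,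
      xpow_mul, KRing.xd, Int.cast_neg, Int.cast_one, neg_smul, one_smul]
    rfl
  map_t := by
    simp [mellinRingEquiv, inclInfty, DiffRing.lift_t, GmRing.lift_x]
  map_tinv := by
    simp [mellinRingEquiv, inclInfty, DiffRing.lift_tinv, GmRing.lift_xinv]

end LocalMellin
end

theorem theorem2 (p : ℂ) :
    (∃ h : ∀ F : (LocalMellin.KRing.regHol.{u} p).FullSubcategory,
        LocalMellin.finLen ((LocalMellin.localMellinZero p).obj F.obj),
      (LocalMellin.mellinFunctorZero p h).IsEquivalence ∧
      LocalMellin.RepresentsZero p (LocalMellin.mellinFunctorZero p h) ∧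
      ∀ G : (LocalMellin.KRing.regHol.{u} p).FullSubcategory ⥤
          (LocalMellin.finLen.{u}).FullSubcategory,
        LocalMellin.RepresentsZero p G → Nonempty (G ≅ LocalMellin.mellinFunctorZero p h)) ∧
    (∃ h : ∀ F : (LocalMellin.KRing.regHol.{u} (-p)).FullSubcategory,
        LocalMellin.finLen ((LocalMellin.localMellinInfty p).obj F.obj),
      (LocalMellin.mellinFunctorInfty p h).IsEquivalence ∧
      LocalMellin.RepresentsInfty p (LocalMellin.mellinFunctorInfty p h) ∧
      ∀ G : (LocalMellin.KRing.regHol.{u} (-p)).FullSubcategory ⥤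
          (LocalMellin.finLen.{u}).FullSubcategory,
        LocalMellin.RepresentsInfty p G → Nonempty (G ≅ LocalMellin.mellinFunctorInfty p h)) := by
  exact ⟨LocalMellin.mellinFunctor_equivalence_and_unique (ε := 1) (by norm_num)
      LocalMellin.isMellinInclusion_inclZero (by simp),
    LocalMellin.mellinFunctor_equivalence_and_unique (ε := -1) (by norm_num)
      LocalMellin.isMellinInclusion_inclInfty (by simp)⟩
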